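/- Let $K$ be a field, $T$ a topological space, $\gamma,\kappa:T\to\mathbb R$ arbitrary (not necessarily continuous) functions, and $i\ge 0$ an integer. For $t\in\mathbb R$ put $\mathcal S^\gamma_t=\{y\in T\mid\gamma(y)\le t\}$ with the subspace topology, and let $H_i(\mathcal S^\gamma)$ be the persistence module (functor from the poset $\mathbb R$ to $K$-vector spaces) given by $t\mapsto H_i(\mathcal S^\gamma_t;K)$ (singular homology), with transition maps induced by the inclusions; likewise for $\kappa$. Suppose that $H_i(\mathcal S^\gamma)$ and $H_i(\mathcal S^\kappa)$ are pointwise finite dimensional, that is, $\dim_K H_i(\mathcal S^\gamma_t;K)<\infty$ and $\dim_K H_i(\mathcal S^\kappa_t;K)<\infty$ for all $t\in\mathbb R$. A barcode is a multiset $\mathcal B$ of non-empty intervals of $\mathbb R$ (with finite multiplicities, repeated intervals being regarded as distinct elements). It is a barcode of a persistence module $M$ if $M\cong\bigoplus_{I\in\mathcal B}C(I)$, where $C(I)$ is the interval module: $C(I)_t=K$ for $t\in I$ and $C(I)_t=0$ otherwise, with transition map $C(I)_s\to C(I)_t$, $s\le t$, the identity if $s,t\in I$ and $0$ otherwise. Write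 an interval as $\langle b,d\rangle$ with decorated endpoints $b<d$ in $(\mathbb R\times\{-,+\})\cup\{\pm\infty\}$, where $\mathbb R\times\{-,+\}$ has the lexicographic order with $-<+$, the elements $-\infty$ and $\infty$ are the minimum and the maximum, and $t^{\pm}=(t,\pm)$ (so, for example, $\langle s^-,t^-\rangle=[s,t)$ and $\langle s^+,t^+\rangle=(s,t]$); put $s^\pm+r=(s+r)^\pm$ and $\pm\infty+r=\pm\infty$ for $r\in\mathbb R$. For $\delta\ge 0$, a $\delta$-matching between barcodes $\mathcal C$ and $\mathcal D$ is a bijection $\sigma$ from a subset of $\mathcal C$ to a subset of $\mathcal D$ such that every $\langle b,d\rangle$ in $\mathcal C$ or in $\mathcal D$ with $b+2\delta<d$ is matched, and such that $\langle b,d\rangle\subseteq\langle b'-\delta,d'+\delta\rangle$ and $\langle b',d'\rangle\subseteq\langle b-\delta,d+\delta\rangle$ whenever $\sigma\langle b,d\rangle=\langle b',d'\rangle$. The bottleneck distance is $$d_B(\mathcal C,\mathcal D)=\inf\{\delta\in[0,\infty)\mid\text{there is a }\delta\text{-matching between }\mathcal C\text{ and }\mathcal D\}\in[0,\infty].$$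 Then each of $H_i(\mathcal S^\gamma)$ and $H_i(\mathcal S^\kappa)$ has exactly one barcode, $\mathcal B_{H_i(\mathcal S^\gamma)}$ and $\mathcal B_{H_i(\mathcal S^\kappa)}$ respectively, and $$d_B\bigl(\mathcal B_{H_i(\mathcal S^\gamma)},\mathcal B_{H_i(\mathcal S^\kappa)}\bigr)\le d_\infty(\gamma,\kappa):=\sup_{y\in T}|\gamma(y)-\kappa(y)|\in[0,\infty],$$ where the supremum is taken in $[0,\infty]$ (so it is $0$ if $T$ is empty). -/

import Mathlib

open CategoryTheory
open scoped NNReal ENNReal DirectSum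

noncomputable section

namespace Persistence

universe u v w

/-! ### Decorated endpoints and intervals -/

/-- Decorated endpoints: `ℝ × {-, +}` with the lexicographic order (`false` is the decoration `-`,
`true` is the decoration `+`, and `false < true`), together with a least element `⊥ = -∞` and a
greatest element `⊤ = ∞`. -/
abbrev Endpoint : Type := WithBot (WithTop (ℝ ×ₗ Bool))

/-- The decorated endpoint `t⁻`. -/
def minus (t : ℝ) : Endpoint := ((toLex (t, false) : ℝ ×ₗ Bool) : WithTop (ℝ ×ₗ Bool))

/-- The decorated endpoint `t⁺`. -/
def plus (t : ℝ) : Endpoint := ((toLex (t, true) : ℝ ×ₗ Bool) : WithTop (ℝ ×ₗ Bool))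

/-- The sum of an endpoint and a real number: `s^± + t = (s + t)^±`, `±∞ + t = ±∞`. -/
def Endpoint.shift (e : Endpoint) (t : ℝ) : Endpoint :=
  WithBot.map (WithTop.map fun p : ℝ ×ₗ Bool => toLex ((ofLex p).1 + t, (ofLex p).2)) e

/-- The set of reals `⟨b, d⟩` cut out by two decorated endpoints, e.g. `⟨s⁻, t⁻⟩ = [s, t)` and
`⟨s⁺, t⁺⟩ = (s, t]`. -/
def between (b d : Endpoint) : Set ℝ := {t | b ≤ minus t ∧ plus t ≤ d}

/-- An interval of `ℝ`, recorded as a pair of decorated endpoints `b < d`. By `carrier_injective`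
and `range_carrier` below, these are the same as the nonempty order-convex subsets of `ℝ`. -/
@[ext]
structure Interval : Type where
  b : Endpoint
  d : Endpoint
  lt : b < d

/-- The underlying subset of `ℝ`. -/
def Interval.carrier (I : Interval) : Set ℝ := between I.b I.d

lemma Endpoint.eq_cases (e : Endpoint) :
    e = ⊥ ∨ e = ⊤ ∨ (∃ t, e = minus t) ∨ ∃ t, e = plus t := by
  induction e using WithBot.recBotCoe with
  | bot => exact Or.inl rfl
  | coe e =>
    induction e using WithTop.recTopCoe with
    | top => exact Or.inr (Or.inl rfl)
    | coe e =>
      obtain ⟨s, c⟩ := e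
      cases c
      · exact Or.inr (Or.inr (Or.inl ⟨s, rfl⟩))
      · exact Or.inr (Or.inr (Or.inr ⟨s, rfl⟩))

lemma minus_le_minus_iff (s t : ℝ) : minus s ≤ minus t ↔ s ≤ t := by
  simp only [minus, WithBot.coe_le_coe, WithTop.coe_le_coe, Prod.Lex.toLex_le_toLex]
  simp [le_iff_lt_or_eq]

lemma plus_le_plus_iff (s t : ℝ) : plus s ≤ plus t ↔ s ≤ t := by
  simp only [plus, WithBot.coe_le_coe, WithTop.coe_le_coe, Prod.Lex.toLex_le_toLex]
  simp [le_iff_lt_or_eq]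

lemma plus_le_minus_iff (s t : ℝ) : plus s ≤ minus t ↔ s < t := by
  simp [minus, plus, Prod.Lex.toLex_le_toLex]

lemma minus_le_plus_iff (s t : ℝ) : minus s ≤ plus t ↔ s ≤ t := by
  simp only [minus, plus, WithBot.coe_le_coe, WithTop.coe_le_coe, Prod.Lex.toLex_le_toLex]
  simp [le_iff_lt_or_eq]

lemma minus_lt_plus (t : ℝ) : minus t < plus t :=
  lt_of_not_ge fun h => lt_irrefl _ ((plus_le_minus_iff t t).1 h)

lemma between_nonempty {b d : Endpoint} (h : b < d) : (between b d).Nonempty := by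
  rcases b.eq_cases with rfl | rfl | ⟨s, rfl⟩ | ⟨s, rfl⟩
  · rcases d.eq_cases with rfl | rfl | ⟨t, rfl⟩ | ⟨t, rfl⟩
    · exact absurd h (lt_irrefl _)
    · exact ⟨0, bot_le, le_top⟩
    · exact ⟨t - 1, bot_le, (plus_le_minus_iff _ _).2 (by linarith)⟩
    · exact ⟨t, bot_le, le_rfl⟩
  · exact absurd h not_top_lt
  · rcases d.eq_cases with rfl | rfl | ⟨t, rfl⟩ | ⟨t, rfl⟩
    · exact absurd h not_lt_bot
    · exact ⟨s, le_rfl, le_top⟩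
    · rw [← not_le, minus_le_minus_iff, not_le] at h
      exact ⟨s, le_rfl, (plus_le_minus_iff _ _).2 h⟩
    · rw [← not_le, plus_le_minus_iff, not_lt] at h
      exact ⟨s, le_rfl, (plus_le_plus_iff _ _).2 h⟩
  · rcases d.eq_cases with rfl | rfl | ⟨t, rfl⟩ | ⟨t, rfl⟩
    · exact absurd h not_lt_bot
    · exact ⟨s + 1, (plus_le_minus_iff _ _).2 (by linarith), le_top⟩
    · rw [← not_le, minus_le_plus_iff, not_le] at h
      exact ⟨(s + t) / 2, (plus_le_minus_iff _ _).2 (by linarith),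
        (plus_le_minus_iff _ _).2 (by linarith)⟩
    · rw [← not_le, plus_le_plus_iff, not_le] at h
      exact ⟨t, (plus_le_minus_iff _ _).2 h, le_rfl⟩

lemma between_subset_iff {b d b' d' : Endpoint} (h : b < d) :
    between b d ⊆ between b' d' ↔ b' ≤ b ∧ d ≤ d' := by
  refine ⟨fun H => ⟨?_, ?_⟩, fun H t ht => ⟨H.1.trans ht.1, ht.2.trans H.2⟩⟩
  · by_contra hb
    obtain ⟨t, h1, h2⟩ := between_nonempty (lt_min h (not_le.1 hb))
    have h3 := (H ⟨h1, h2.trans (min_le_left _ _)⟩).1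
    exact absurd ((minus_lt_plus t).trans_le (h2.trans (min_le_right _ _))) (not_lt.2 h3)
  · by_contra hd
    obtain ⟨t, h1, h2⟩ := between_nonempty (max_lt h (not_le.1 hd))
    have h3 := (H ⟨(le_max_left _ _).trans h1, h2⟩).2
    exact absurd (((le_max_right _ _).trans h1).trans_lt (minus_lt_plus t)) (not_lt.2 h3)

lemma Interval.ordConnected_carrier (I : Interval) : I.carrier.OrdConnected := by
  constructor
  intro x hx y hy z hz
  exact ⟨hx.1.trans ((minus_le_minus_iff _ _).2 hz.1), ((plus_le_plus_iff _ _).2 hz.2).trans hy.2⟩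

/-- Different pairs of endpoints give different intervals. -/
lemma Interval.carrier_injective : Function.Injective Interval.carrier := by
  intro I J h
  have h1 := (between_subset_iff I.lt).1 (show I.carrier ⊆ J.carrier from h.le)
  have h2 := (between_subset_iff J.lt).1 (show J.carrier ⊆ I.carrier from h.ge)
  exact Interval.ext (le_antisymm h2.1 h1.1) (le_antisymm h1.2 h2.2)

/-- The intervals are exactly the nonempty order-convex sets of reals. -/
lemma Interval.range_carrier :
    Set.range Interval.carrier = {S : Set ℝ | S.Nonempty ∧ S.OrdConnected} := by
  apply Set.Subset.antisymm
  · rintro _ ⟨I, rfl⟩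
    exact ⟨between_nonempty I.lt, I.ordConnected_carrier⟩
  rintro S ⟨hne, hS⟩
  obtain ⟨b, hb⟩ : ∃ b : Endpoint, ∀ t, b ≤ minus t ↔ ∃ x ∈ S, x ≤ t := by
    by_cases hbdd : BddBelow S
    · by_cases ha : sInf S ∈ S
      · refine ⟨minus (sInf S), fun t => ?_⟩
        rw [minus_le_minus_iff]
        exact ⟨fun h => ⟨_, ha, h⟩, fun ⟨x, hx, h⟩ => (csInf_le hbdd hx).trans h⟩
      · refine ⟨plus (sInf S), fun t => ?_⟩
        rw [plus_le_minus_iff]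
        constructor
        · intro h
          obtain ⟨x, hx, h⟩ := exists_lt_of_csInf_lt hne h
          exact ⟨x, hx, h.le⟩
        · rintro ⟨x, hx, h⟩
          refine lt_of_lt_of_le (lt_of_le_of_ne (csInf_le hbdd hx) ?_) h
          rintro h
          exact ha (h ▸ hx)
    · refine ⟨⊥, fun t => ⟨fun _ => ?_, fun _ => bot_le⟩⟩
      obtain ⟨x, hx, h⟩ := not_bddBelow_iff.1 hbdd t
      exact ⟨x, hx, h.le⟩
  obtain ⟨d, hd⟩ : ∃ d : Endpoint, ∀ t, plus t ≤ d ↔ ∃ x ∈ S, t ≤ x := by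
    by_cases hbdd : BddAbove S
    · by_cases ha : sSup S ∈ S
      · refine ⟨plus (sSup S), fun t => ?_⟩
        rw [plus_le_plus_iff]
        exact ⟨fun h => ⟨_, ha, h⟩, fun ⟨x, hx, h⟩ => h.trans (le_csSup hbdd hx)⟩
      · refine ⟨minus (sSup S), fun t => ?_⟩
        rw [plus_le_minus_iff]
        constructor
        · intro h
          obtain ⟨x, hx, h⟩ := exists_lt_of_lt_csSup hne h
          exact ⟨x, hx, h.le⟩
        · rintro ⟨x, hx, h⟩
          refine lt_of_le_of_lt h (lt_of_le_of_ne (le_csSup hbdd hx) ?_)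
          rintro h
          exact ha (h ▸ hx)
    · refine ⟨⊤, fun t => ⟨fun _ => ?_, fun _ => le_top⟩⟩
      obtain ⟨x, hx, h⟩ := not_bddAbove_iff.1 hbdd t
      exact ⟨x, hx, h.le⟩
  obtain ⟨x, hx⟩ := hne
  refine ⟨⟨b, d, (((hb x).2 ⟨x, hx, le_rfl⟩).trans_lt (minus_lt_plus x)).trans_le
    ((hd x).2 ⟨x, hx, le_rfl⟩)⟩, ?_⟩
  ext t
  constructor
  · rintro ⟨h1, h2⟩
    obtain ⟨y, hy, hyt⟩ := (hb t).1 h1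
    obtain ⟨z, hz, htz⟩ := (hd t).1 h2
    exact hS.out hy hz ⟨hyt, htz⟩
  · exact fun ht => ⟨(hb t).2 ⟨t, ht, le_rfl⟩, (hd t).2 ⟨t, ht, le_rfl⟩⟩

/-! ### Persistence modules -/

/-- Pointwise finite dimensional persistence modules. -/
def IsPFD {K : Type v} [Field K] (M : ℝ ⥤ ModuleCat.{w} K) : Prop :=
  ∀ t : ℝ, Module.Finite K (M.obj t)

open Classical in
/-- The value of the interval module at `t`: it is `K` if `t ∈ I`, and `0` otherwise. -/
def intervalSpace (K : Type v) [Field K] (I : Interval) (t : ℝ) : Submodule K K :=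
  if t ∈ I.carrier then ⊤ else ⊥

open Classical in
/-- The transition map of the interval module: the identity if `s, t ∈ I`, and `0` otherwise. -/
def intervalMap (K : Type v) [Field K] (I : Interval) (s t : ℝ) :
    intervalSpace K I s →ₗ[K] intervalSpace K I t :=
  if h : s ∈ I.carrier ∧ t ∈ I.carrier then
    Submodule.inclusion (by simp [intervalSpace, h.1, h.2])
  else 0

/-- The interval persistence module `C(I)`. -/
def intervalModule (K : Type v) [Field K] (I : Interval) : ℝ ⥤ ModuleCat.{v} K where
  obj t := ModuleCat.of K (intervalSpace K I t)
  map {s t} _ := ModuleCat.ofHom (intervalMap K I s t)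
  map_id t := by
    ext ⟨x, hx⟩
    by_cases h : t ∈ I.carrier
    · simp [intervalMap, h]
    · have hx' : x = 0 := by simpa [intervalSpace, h] using hx
      simp [intervalMap, h, hx']
  map_comp {r s t} f g := by
    ext x
    by_cases hr : r ∈ I.carrier
    · by_cases ht : t ∈ I.carrier
      · have hs : s ∈ I.carrier := I.ordConnected_carrier.out hr ht ⟨leOfHom f, leOfHom g⟩
        simp [intervalMap, hr, hs, ht]
      · simp [intervalMap, ht]
    · simp [intervalMap, hr]

/-! ### Barcodes -/

/-- A multiset of intervals, given by its multiplicity function; intervals of multiplicity `0` do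
not belong to the multiset. -/
structure Barcode : Type where
  mult : Interval → ℕ

/-- The elements of a barcode: intervals `I` with an index counting the `mult I` copies of `I`. -/
def Barcode.Elem (B : Barcode) : Type := Σ I : Interval, Fin (B.mult I)

/-- The interval of an element of a barcode. -/
def Barcode.Elem.interval {B : Barcode} (x : B.Elem) : Interval := x.1

/-- The direct sum `⨁ C(I)` over all elements `I` of a barcode, formed pointwise. -/
def barcodeModule (K : Type v) [Field K] (B : Barcode) : ℝ ⥤ ModuleCat.{v} K where
  obj t := ModuleCat.of K (⨁ x : B.Elem, (intervalModule K x.interval).obj t)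
  map f := ModuleCat.ofHom
    (DirectSum.lmap fun x : B.Elem => ((intervalModule K x.interval).map f).hom)
  map_id t := by
    simp only [CategoryTheory.Functor.map_id, ModuleCat.hom_id, DirectSum.lmap_id]
    rfl
  map_comp f g := by
    simp only [CategoryTheory.Functor.map_comp, ModuleCat.hom_comp, DirectSum.lmap_comp]
    rfl

/-- `B` is a barcode of `M`: there is an isomorphism of persistence modules `M ≅ ⨁_{I ∈ B} C(I)`,
that is, a family of linear isomorphisms commuting with the transition maps. (It is written out,
and not as an isomorphism in a functor category, so that `M` may live in any universe.) -/
def IsBarcodeOf {K : Type v} [Field K] (B : Barcode) (M : ℝ ⥤ ModuleCat.{w} K) : Prop :=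
  ∃ e : ∀ t : ℝ, M.obj t ≃ₗ[K] (barcodeModule K B).obj t,
    ∀ (s t : ℝ) (h : s ≤ t) (x : M.obj s),
      e t ((M.map (homOfLE h)).hom x) = ((barcodeModule K B).map (homOfLE h)).hom (e s x)

/-! ### Matchings and the bottleneck distance -/

/-- The elements `⟨b, d⟩` of a barcode with `b + ε < d`. -/
def Barcode.long (B : Barcode) (ε : ℝ) : Set B.Elem :=
  {x | x.interval.b.shift ε < x.interval.d}

/-- A matching between two barcodes is a bijection between a subset of the first and a subset of
the second, i.e. a term of Mathlib's type `C.Elem ≃. D.Elem` of partial bijections, where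
`σ x = some y` says that `x` is matched to `y`. It is a `δ`-matching if all elements of `C^{2δ}` and
of `D^{2δ}` are matched, and matched intervals are contained in the `δ`-thickenings of each
other. -/
structure IsDeltaMatching {C D : Barcode} (δ : ℝ) (σ : C.Elem ≃. D.Elem) : Prop where
  dom : ∀ x ∈ C.long (2 * δ), ∃ y, σ x = some y
  im : ∀ y ∈ D.long (2 * δ), ∃ x, σ x = some y
  subset_left : ∀ x y, σ x = some y →
    between x.interval.b x.interval.d ⊆ between (y.interval.b.shift (-δ)) (y.interval.d.shift δ)
  subset_right : ∀ x y, σ x = some y →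
    between y.interval.b y.interval.d ⊆ between (x.interval.b.shift (-δ)) (x.interval.d.shift δ)

/-- The bottleneck distance, with values in `[0, ∞]`. -/
def bottleneckDist (C D : Barcode) : ℝ≥0∞ :=
  sInf {r : ℝ≥0∞ | ∃ δ : ℝ≥0, r = δ ∧ ∃ σ : C.Elem ≃. D.Elem, IsDeltaMatching (δ : ℝ) σ}

/-! ### Sublevel-set persistent homology -/

/-- The sublevel-set filtration `t ↦ {y | γ y ≤ t}` of a (not necessarily continuous) function, with
the inclusions as transition maps; sublevel sets carry the subspace topology. -/
def sublevel {T : Type u} [TopologicalSpace T] (γ : T → ℝ) : ℝ ⥤ TopCat.{u} where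
  obj t := TopCat.of {y : T | γ y ≤ t}
  map {s t} f := TopCat.ofHom
    ⟨Set.inclusion fun _ hy => le_trans hy (leOfHom f), continuous_inclusion _⟩

/-- The sublevel-set persistent homology `H_i(S^γ)`: singular homology with coefficients in `K`,
applied to the sublevel-set filtration. (The lift of `K` only adjusts its universe.) -/
def sublevelHomology (K : Type v) [Field K] {T : Type u} [TopologicalSpace T] (γ : T → ℝ) (i : ℕ) :
    ℝ ⥤ ModuleCat.{max u v} K :=
  sublevel γ ⋙ (AlgebraicTopology.singularHomologyFunctor (ModuleCat.{max u v} K) i).obj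
    (ModuleCat.of K (ULift.{u} K))

/-- The sup-distance `sup_y |γ y - κ y|` of two functions, with values in `[0, ∞]`. -/
def supDist {T : Type u} (γ κ : T → ℝ) : ℝ≥0∞ := ⨆ y : T, ENNReal.ofReal |γ y - κ y|

end Persistence

end

noncomputable section

namespace Persistence

universe u v w

/-! ### Shifts of endpoints -/

/-! Topology enters only through functoriality: if `γ` and `κ` differ by at most `δ`, each sublevel
set of one lies in the sublevel set of the other at level `t + δ`, so the homology modules are
`δ`-interleaved by maps `F`, `G`. The rest is linear algebra.

Existence of barcodes (`exists_isBarBasis`): Zorn's lemma gives a maximal orthogonal family of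
interval summands. The common kernel of its coordinates is a complementary submodule; if that were
nonzero, `exists_bar` would split off one more summand. The new summand comes from a nonzero vector
of earliest possible origin, followed forward until it dies, lifted backward compatibly, and paired
with a compatible functional equal to `1` on it.

Stability (`exists_injective_close`): in bases of bars, `F` and `G` become matrices of scalars. A
coefficient from `I` to `J` can be nonzero only if the endpoints of `J` exceed those of `I` by at
most `δ`. If `I → J → I'` is such a path and `J` is `δ`-close to neither `I` nor `I'`, then the
endpoints of `I'` have a smaller sum than those of `I`. Since the composite of `F` and `G` is the
transition map by `2δ`, restricting the matrices to bars close to a finite set of bars longer than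
`2δ` leaves a unitriangular product. So these long bars are at most as many as the bars close to
them. This is Hall's condition, hence long bars inject into close bars. The injections in both
directions combine to one matching as in the Schröder–Bernstein theorem.

Uniqueness is the case `δ = 0`: two barcodes of the same module have a `0`-matching, which forces
equality. -/

lemma Endpoint.shift_bot (r : ℝ) : Endpoint.shift ⊥ r = ⊥ := rfl

lemma Endpoint.shift_top (r : ℝ) : Endpoint.shift ⊤ r = ⊤ := rfl

lemma shift_minus (s r : ℝ) : (minus s).shift r = minus (s + r) := rfl

lemma shift_plus (s r : ℝ) : (plus s).shift r = plus (s + r) := rfl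

lemma Endpoint.shift_shift (e : Endpoint) (r r' : ℝ) :
    (e.shift r).shift r' = e.shift (r + r') := by
  rcases e.eq_cases with rfl | rfl | ⟨s, rfl⟩ | ⟨s, rfl⟩
  · rfl
  · rfl
  · rw [shift_minus, shift_minus, shift_minus, add_assoc]
  · rw [shift_plus, shift_plus, shift_plus, add_assoc]

lemma Endpoint.shift_zero (e : Endpoint) : e.shift 0 = e := by
  rcases e.eq_cases with rfl | rfl | ⟨s, rfl⟩ | ⟨s, rfl⟩
  · rfl
  · rfl
  · rw [shift_minus, add_zero]
  · rw [shift_plus, add_zero]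

lemma Endpoint.shift_mono (r : ℝ) {e e' : Endpoint} (h : e ≤ e') : e.shift r ≤ e'.shift r := by
  refine Monotone.withBot_map (Monotone.withTop_map fun p q h => ?_) h
  rw [Prod.Lex.le_iff] at h ⊢
  simpa using h

lemma Endpoint.shift_le_shift_iff {e e' : Endpoint} (r : ℝ) :
    e.shift r ≤ e'.shift r ↔ e ≤ e' := by
  refine ⟨fun h => ?_, fun h => shift_mono r h⟩
  have := shift_mono (-r) h
  simpa [shift_shift, shift_zero] using this

lemma Endpoint.shift_lt_shift_iff {e e' : Endpoint} (r : ℝ) :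
    e.shift r < e'.shift r ↔ e < e' := by
  rw [← not_le, ← not_le, shift_le_shift_iff]

lemma Endpoint.shift_neg_le_iff {e e' : Endpoint} (r : ℝ) :
    e.shift (-r) ≤ e' ↔ e ≤ e'.shift r := by
  rw [← shift_le_shift_iff r, shift_shift, neg_add_cancel, shift_zero]

lemma Endpoint.shift_le_minus_iff {e : Endpoint} (r t : ℝ) :
    e.shift r ≤ minus t ↔ e ≤ minus (t - r) := by
  rw [← shift_le_shift_iff r (e' := minus (t - r)), shift_minus, sub_add_cancel]

lemma Endpoint.plus_le_shift_iff {e : Endpoint} (r t : ℝ) :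
    plus t ≤ e.shift r ↔ plus (t - r) ≤ e := by
  rw [← shift_le_shift_iff r (e := plus (t - r)), shift_plus, sub_add_cancel]

lemma not_plus_le_of_le_minus {e : Endpoint} {t : ℝ} (h : e ≤ minus t) : ¬ plus t ≤ e :=
  fun h' => absurd (h'.trans h) (not_le.2 (minus_lt_plus t))

/-! ### A linear order on intervals by midpoints -/

/-- The sign of an endpoint: `-1` for `-∞`, `1` for `∞` and `0` for the finite ones. -/
def Endpoint.infSign : Endpoint → ℤ
  | ⊥ => -1
  | (⊤ : WithTop (ℝ ×ₗ Bool)) => 1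
  | ((_ : ℝ ×ₗ Bool) : WithTop (ℝ ×ₗ Bool)) => 0

/-- The position of a finite endpoint in an ordered group in which endpoints can be added. -/
def Endpoint.position : Endpoint → ℝ ×ₗ ℤ
  | ⊥ => 0
  | (⊤ : WithTop (ℝ ×ₗ Bool)) => 0
  -- The decoration becomes an integer so that positions of two endpoints can be added while the
  -- lexicographic order is kept.
  | ((p : ℝ ×ₗ Bool) : WithTop (ℝ ×ₗ Bool)) => toLex ((ofLex p).1, if (ofLex p).2 then 1 else 0)

lemma infSign_minus (t : ℝ) : (minus t).infSign = 0 := rfl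
lemma infSign_plus (t : ℝ) : (plus t).infSign = 0 := rfl
lemma infSign_bot : Endpoint.infSign ⊥ = -1 := rfl
lemma infSign_top : Endpoint.infSign ⊤ = 1 := rfl
lemma position_minus (t : ℝ) : (minus t).position = toLex (t, 0) := rfl
lemma position_plus (t : ℝ) : (plus t).position = toLex (t, 1) := rfl
lemma position_bot : Endpoint.position ⊥ = 0 := rfl
lemma position_top : Endpoint.position ⊤ = 0 := rfl

lemma Endpoint.lt_cases_of_shift_lt {e e' : Endpoint} {r : ℝ} (h : e'.shift r < e) :
    e'.infSign < e.infSign ∨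
      e'.infSign = e.infSign ∧ e'.position + toLex (r, 0) < e.position := by
  rcases e.eq_cases with rfl | rfl | ⟨s, rfl⟩ | ⟨s, rfl⟩ <;>
  rcases e'.eq_cases with rfl | rfl | ⟨s', rfl⟩ | ⟨s', rfl⟩ <;>
  simp only [shift_bot, shift_top, shift_minus, shift_plus, ← not_le, minus_le_minus_iff,
    minus_le_plus_iff, plus_le_minus_iff, plus_le_plus_iff, infSign_minus, infSign_plus,
    infSign_bot, infSign_top, position_minus, position_plus, position_bot, position_top,
    bot_le, le_top, not_true, le_refl] at h ⊢ <;>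
  norm_num at h ⊢ <;>
  rw [← toLex_add, Prod.mk_add_mk, Prod.Lex.toLex_lt_toLex]
  · exact Or.inl h
  · exact Or.inl h
  · rcases h.lt_or_eq with h | h
    · exact Or.inl h
    · exact Or.inr ⟨h, by norm_num⟩
  · exact Or.inl h

lemma Endpoint.le_cases_of_le_shift {e e' : Endpoint} {r : ℝ} (hr : 0 ≤ r)
    (h : e' ≤ e.shift r) :
    e'.infSign < e.infSign ∨
      e'.infSign = e.infSign ∧ e'.position ≤ e.position + toLex (r, 0) := by
  have hr' : (0 : ℝ ×ₗ ℤ) ≤ 0 + toLex (r, 0) := by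
    rw [zero_add, ← toLex_zero, Prod.Lex.toLex_le_toLex]
    rcases hr.lt_or_eq with h | h
    · exact Or.inl h
    · exact Or.inr ⟨h, le_rfl⟩
  rcases h.lt_or_eq with h | rfl
  · by_contra hc
    push Not at hc
    rcases e.eq_cases with rfl | rfl | ⟨s, rfl⟩ | ⟨s, rfl⟩ <;>
    rcases e'.eq_cases with rfl | rfl | ⟨s', rfl⟩ | ⟨s', rfl⟩ <;>
    simp only [shift_bot, shift_top, shift_minus, shift_plus, ← not_le, minus_le_minus_iff,
      minus_le_plus_iff, plus_le_minus_iff, plus_le_plus_iff, infSign_minus, infSign_plus,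
      infSign_bot, infSign_top, position_minus, position_plus, position_bot, position_top,
      bot_le, le_top, not_true, le_refl, hr'] at h hc <;>
    norm_num at h hc <;>
    rw [← toLex_add, Prod.mk_add_mk, Prod.Lex.toLex_lt_toLex] at hc <;>
    rcases hc with hc | ⟨hc, hc'⟩ <;>
    norm_num at hc <;>
    linarith
  · rcases e.eq_cases with rfl | rfl | ⟨s, rfl⟩ | ⟨s, rfl⟩
    · exact Or.inr ⟨rfl, hr'⟩
    · exact Or.inr ⟨rfl, hr'⟩
    · exact Or.inr ⟨rfl, by rw [shift_minus, position_minus, position_minus, ← toLex_add,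
        Prod.mk_add_mk, add_zero]⟩
    · exact Or.inr ⟨rfl, by rw [shift_plus, position_plus, position_plus, ← toLex_add,
        Prod.mk_add_mk, add_zero]⟩

/-- A key that compares intervals by the sum of their endpoints. -/
def Interval.key (I : Interval) : ℤ ×ₗ (ℝ ×ₗ ℤ) :=
  toLex (I.b.infSign + I.d.infSign, I.b.position + I.d.position)

/-- One endpoint drops by more than `r` and the other rises by at most `r`, so the sum drops.
Comparing endpoint by endpoint makes the value `0` given to the position of infinite endpoints
harmless: those are separated by their signs or are equal. -/
lemma sum_lt_sum_of_shift {e₁ e₂ e₃ e₄ : Endpoint} {r : ℝ} (hr : 0 ≤ r)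
    (h : e₂.shift r < e₁) (h' : e₄ ≤ e₃.shift r) :
    (toLex (e₂.infSign + e₄.infSign, e₂.position + e₄.position) : ℤ ×ₗ (ℝ ×ₗ ℤ)) <
      toLex (e₁.infSign + e₃.infSign, e₁.position + e₃.position) := by
  rw [Prod.Lex.toLex_lt_toLex]
  rcases Endpoint.lt_cases_of_shift_lt h with h | ⟨h, hp⟩ <;>
  rcases Endpoint.le_cases_of_le_shift hr h' with h' | ⟨h', hp'⟩
  · exact Or.inl (by simpa using add_lt_add h h')
  · exact Or.inl (by simpa using add_lt_add_of_lt_of_le h h'.le)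
  · exact Or.inl (by simpa using add_lt_add_of_le_of_lt h.le h')
  · refine Or.inr ⟨by simp [h, h'], ?_⟩
    have := add_lt_add_of_lt_of_le hp hp'
    rw [add_right_comm, ← add_assoc] at this
    exact lt_of_add_lt_add_right this

lemma Interval.key_lt_of_d {I J : Interval} {r : ℝ} (hr : 0 ≤ r) (h : J.d.shift r < I.d)
    (h' : J.b ≤ I.b.shift r) : J.key < I.key := by
  have := sum_lt_sum_of_shift hr h h'
  rwa [add_comm J.d.infSign, add_comm J.d.position, add_comm I.d.infSign,
    add_comm I.d.position] at this

lemma Interval.key_lt_of_b {I J : Interval} {r : ℝ} (hr : 0 ≤ r) (h : J.b.shift r < I.b)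
    (h' : J.d ≤ I.d.shift r) : J.key < I.key :=
  sum_lt_sum_of_shift hr h h'

lemma Interval.key_lt_of_lt {I J : Interval} (h : J.b < I.b) (h' : J.d < I.d) :
    J.key < I.key :=
  key_lt_of_b le_rfl (by rwa [Endpoint.shift_zero]) (by rw [Endpoint.shift_zero]; exact h'.le)

/-! ### Intervals related by nonzero morphisms -/

/-- `J.Below δ I` says that there are nonzero morphisms `C(I) → C(J)(δ)`, apart from the condition
that `I` and the translate of `J` intersect. -/
def Interval.Below (δ : ℝ) (J I : Interval) : Prop :=
  J.b ≤ I.b.shift δ ∧ J.d ≤ I.d.shift δ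

/-- Two intervals are close if they are contained in the thickenings of each other. -/
def Interval.Close (δ : ℝ) (I J : Interval) : Prop :=
  J.Below δ I ∧ I.Below δ J

lemma Interval.Close.symm {δ : ℝ} {I J : Interval} (h : I.Close δ J) : J.Close δ I :=
  And.symm h

/-- Nonvanishing of a morphism `C(I) → C(J)(δ)` at one `t` propagates backward inside `I` and
forward inside `J`; this forces the order of both pairs of endpoints. -/
lemma Interval.below_of_forall {I J : Interval} {δ t : ℝ} (ht : t ∈ I.carrier)
    (ht' : t + δ ∈ J.carrier) (h : ∀ s ≤ t, s ∈ I.carrier → s + δ ∈ J.carrier)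
    (h' : ∀ s, t ≤ s → s + δ ∈ J.carrier → s ∈ I.carrier) : J.Below δ I := by
  constructor
  · by_contra hb
    have h1 : I.b.shift δ < plus (t + δ) :=
      ((Endpoint.shift_mono δ ht.1).trans_eq (shift_minus t δ)).trans_lt (minus_lt_plus _)
    -- A point `p` after the shifted start of `I` but before the start of `J`: `p - δ` lies in `I`,
    -- yet `p` is not in `J`.
    obtain ⟨p, hp, hp'⟩ := between_nonempty (lt_min (not_le.1 hb) h1)
    have hpt : p ≤ t + δ := (plus_le_plus_iff _ _).1 (hp'.trans (min_le_right _ _))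
    have := (h (p - δ) (by linarith) ⟨(Endpoint.shift_le_minus_iff _ _).1 hp,
      ((plus_le_plus_iff _ _).2 (by linarith)).trans ht.2⟩).1
    rw [sub_add_cancel] at this
    exact not_plus_le_of_le_minus this (hp'.trans (min_le_left _ _))
  · by_contra hd
    have h1 : minus (t + δ) < J.d := (minus_lt_plus _).trans_le ht'.2
    obtain ⟨p, hp, hp'⟩ := between_nonempty (max_lt (not_le.1 hd) h1)
    have hpt : t + δ ≤ p := (minus_le_minus_iff _ _).1 ((le_max_right _ _).trans hp)
    have := (h' (p - δ) (by linarith) ⟨?_, ?_⟩).2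
    · rw [← Endpoint.plus_le_shift_iff] at this
      exact not_plus_le_of_le_minus ((le_max_left _ _).trans hp) this
    · rw [sub_add_cancel]
      exact ht'.1.trans ((minus_le_minus_iff _ _).2 hpt)
    · rwa [sub_add_cancel]

lemma Interval.Below.trans {δ : ℝ} {I J I' : Interval} (h : J.Below δ I) (h' : I'.Below δ J) :
    I'.Below (2 * δ) I := by
  rw [Below, two_mul, ← Endpoint.shift_shift, ← Endpoint.shift_shift]
  exact ⟨h'.1.trans (Endpoint.shift_mono δ h.1), h'.2.trans (Endpoint.shift_mono δ h.2)⟩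

/-- Failing closeness means that some endpoint drops by more than `δ` in each of the two steps. If
it is the same endpoint both times, it drops by more than `2δ` while the other rises by at most
`2δ`. If not, each endpoint drops by more than it can rise, so both drop. -/
lemma Interval.Below.key_lt {δ : ℝ} (hδ : 0 ≤ δ) {I J I' : Interval} (h : J.Below δ I)
    (h' : I'.Below δ J) (hI : ¬ I.Close δ J) (hI' : ¬ I'.Close δ J) : I'.key < I.key := by
  have hδ2 : 0 ≤ 2 * δ := by linarith
  obtain ⟨hb, hd⟩ := h.trans h'
  have h1 : J.b.shift δ < I.b ∨ J.d.shift δ < I.d := by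
    by_contra! hc
    exact hI ⟨h, hc⟩
  have h2 : I'.b.shift δ < J.b ∨ I'.d.shift δ < J.d := by
    by_contra! hc
    exact hI' ⟨hc, h'⟩
  rcases h1 with h1 | h1 <;> rcases h2 with h2 | h2
  · refine key_lt_of_b hδ2 ?_ hd
    rw [two_mul, ← Endpoint.shift_shift]
    exact ((Endpoint.shift_lt_shift_iff δ).2 h2).trans h1
  · refine key_lt_of_lt (h'.1.trans_lt h1) ?_
    exact (Endpoint.shift_lt_shift_iff δ).1 (h2.trans_le h.2)
  · refine key_lt_of_lt ?_ (h'.2.trans_lt h1)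
    exact (Endpoint.shift_lt_shift_iff δ).1 (h2.trans_le h.1)
  · refine key_lt_of_d hδ2 ?_ hb
    rw [two_mul, ← Endpoint.shift_shift]
    exact ((Endpoint.shift_lt_shift_iff δ).2 h2).trans h1

/-- The nonzero composites `C(I) → C(J)(δ) → C(I')(2δ)` pass through `J`. -/
lemma Interval.Below.mem {δ t : ℝ} {I J I' : Interval} (h : J.Below δ I)
    (h' : I'.Below δ J) (ht : t ∈ I.carrier) (ht' : t + δ + δ ∈ I'.carrier) :
    t + δ ∈ J.carrier := by
  constructor
  · exact h.1.trans ((Endpoint.shift_mono δ ht.1).trans_eq (shift_minus t δ))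
  · have := ht'.2.trans h'.2
    rwa [← shift_plus, Endpoint.shift_le_shift_iff] at this

/-- Treats pairs for which the transition map by `2δ` gives no information. Being disjoint from the
shifted `I`, the interval `I'` ends no later than `I.b.shift (2 * δ)`; as both intervals are long,
both endpoints of `I'` precede those of `I`. -/
lemma Interval.Below.key_lt_of_disjoint {δ : ℝ} {I J I' : Interval} (h : J.Below δ I)
    (h' : I'.Below δ J) (hI : I.b.shift (2 * δ) < I.d) (hI' : I'.b.shift (2 * δ) < I'.d)
    (hdisj : ∀ t ∈ I.carrier, t + δ + δ ∉ I'.carrier) : I'.key < I.key := by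
  obtain ⟨hb, hd⟩ := h.trans h'
  rcases le_or_gt I'.d (I.b.shift (2 * δ)) with hle | hlt
  · exact key_lt_of_lt ((Endpoint.shift_lt_shift_iff _).1 (hI'.trans_le hle)) (hle.trans_lt hI)
  · obtain ⟨p, hp, hp'⟩ := between_nonempty hlt
    refine absurd ?_ (hdisj (p - 2 * δ) ⟨(Endpoint.shift_le_minus_iff _ _).1 hp,
      (Endpoint.plus_le_shift_iff _ _).1 (hp'.trans hd)⟩)
    rw [show p - 2 * δ + δ + δ = p by ring]
    exact ⟨hb.trans hp, hp'⟩

lemma Interval.exists_mem_of_long {δ : ℝ} (hδ : 0 ≤ δ) {I : Interval}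
    (hI : I.b.shift (2 * δ) < I.d) : ∃ t ∈ I.carrier, t + δ + δ ∈ I.carrier := by
  obtain ⟨p, hp, hp'⟩ := between_nonempty hI
  have hp2 := (Endpoint.shift_le_minus_iff _ _).1 hp
  refine ⟨p - 2 * δ, ⟨hp2, ((plus_le_plus_iff _ _).2 (by linarith)).trans hp'⟩, ?_⟩
  rw [show p - 2 * δ + δ + δ = p by ring]
  exact ⟨hp2.trans ((minus_le_minus_iff _ _).2 (by linarith)), hp'⟩

/-! ### Compatible families of functionals -/

section Functionals

variable {K : Type v} [Field K] {ι : Type u} [Preorder ι] [IsDirectedOrder ι]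
  {G : ι → Type w} [∀ i, AddCommGroup (G i)] [∀ i, Module K (G i)]
  (g : ∀ i j, i ≤ j → G i →ₗ[K] G j) [DirectedSystem G (g · · ·)]

/-- A compatible family is a functional on the direct limit. Vectors killed in the limit are killed
at a finite stage, so `ψ` descends to the image of `G i₀` there and extends from this subspace. -/
lemma exists_compatible_functionals (i₀ : ι) (ψ : G i₀ →ₗ[K] K)
    (hψ : ∀ j (h : i₀ ≤ j) x, g i₀ j h x = 0 → ψ x = 0) :
    ∃ φ : ∀ i, G i →ₗ[K] K, (∀ i j h x, φ j (g i j h x) = φ i x) ∧ φ i₀ = ψ := by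
  classical
  have hker : LinearMap.ker (Module.DirectLimit.of K ι G g i₀) ≤ LinearMap.ker ψ := by
    intro x hx
    obtain ⟨j, hj, hx⟩ := Module.DirectLimit.of.zero_exact (LinearMap.mem_ker.1 hx)
    exact hψ j hj x hx
  obtain ⟨Φ, hΦ⟩ := LinearMap.exists_extend
    ((LinearMap.ker (Module.DirectLimit.of K ι G g i₀)).liftQ ψ hker ∘ₗ
      (LinearMap.quotKerEquivRange (Module.DirectLimit.of K ι G g i₀)).symm.toLinearMap)
  refine ⟨fun i => Φ ∘ₗ Module.DirectLimit.of K ι G g i, fun i j h x => ?_, ?_⟩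
  · simp
  · ext x
    have := LinearMap.congr_fun hΦ ⟨_, LinearMap.mem_range_self _ x⟩
    simpa using this

lemma exists_compatible_functionals_apply_eq_one (i₀ : ι) (x₀ : G i₀)
    (hx₀ : ∀ j (h : i₀ ≤ j), g i₀ j h x₀ ≠ 0) :
    ∃ φ : ∀ i, G i →ₗ[K] K, (∀ i j h x, φ j (g i j h x) = φ i x) ∧ φ i₀ x₀ = 1 := by
  classical
  have hne : Module.DirectLimit.of K ι G g i₀ x₀ ∉
      (⊥ : Submodule K (Module.DirectLimit G g)) := by
    intro hx
    obtain ⟨j, hj, hx⟩ := Module.DirectLimit.of.zero_exact ((Submodule.mem_bot K).1 hx)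
    exact hx₀ j hj hx
  obtain ⟨Φ, -, hΦ⟩ := LinearMap.exists_extend_of_notMem (0 : _ →ₗ[K] K) hne 1
  exact ⟨fun i => Φ ∘ₗ Module.DirectLimit.of K ι G g i, fun i j h x => by simp, hΦ⟩

end Functionals

/-! ### Interval summands -/

section Bars

variable {K : Type v} [Field K] {V : ℝ → Type w} [∀ t, AddCommGroup (V t)]
  [∀ t, Module K (V t)]

/-- An interval summand of a system of vector spaces: a compatible family of vectors `vec t`, which
spans the summand, and a compatible family of functionals `coord t`, which gives the projection. -/
structure Bar (f : ∀ s t : ℝ, s ≤ t → V s →ₗ[K] V t) where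
  I : Interval
  vec : ∀ t, V t
  coord : ∀ t, V t →ₗ[K] K
  map_vec : ∀ {s t : ℝ} (h : s ≤ t), s ∈ I.carrier → f s t h (vec s) = vec t
  vec_eq_zero : ∀ {t : ℝ}, t ∉ I.carrier → vec t = 0
  coord_map : ∀ {s t : ℝ} (h : s ≤ t), t ∈ I.carrier → ∀ z, coord t (f s t h z) = coord s z
  coord_eq_zero : ∀ {t : ℝ}, t ∉ I.carrier → coord t = 0
  coord_vec : ∀ {t : ℝ}, t ∈ I.carrier → coord t (vec t) = 1

variable (f : ∀ s t : ℝ, s ≤ t → V s →ₗ[K] V t) [DirectedSystem V (f · · ·)]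

lemma map_map_apply {r s t : ℝ} (h : r ≤ s) (h' : s ≤ t) (z : V r) :
    f s t h' (f r s h z) = f r t (h.trans h') z :=
  DirectedSystem.map_map (f := (f · · ·)) h h' z

lemma map_self_apply {t : ℝ} (z : V t) : f t t le_rfl z = z :=
  DirectedSystem.map_self (f := (f · · ·)) z

lemma range_mono {r s t : ℝ} (h : r ≤ s) (h' : s ≤ t) :
    LinearMap.range (f r t (h.trans h')) ≤ LinearMap.range (f s t h') := by
  rintro _ ⟨x, rfl⟩
  exact ⟨f r s h x, map_map_apply f h h' x⟩

/-- In a nonzero space there is a nonzero vector that comes from as early as any nonzero vector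
can. -/
lemma exists_mem_range_of_range_ne_bot {t₀ : ℝ} [Module.Finite K (V t₀)] [Nontrivial (V t₀)] :
    ∃ v : V t₀, v ≠ 0 ∧
      ∀ s (h : s ≤ t₀), LinearMap.range (f s t₀ h) ≠ ⊥ → v ∈ LinearMap.range (f s t₀ h) := by
  let S : Set (Submodule K (V t₀)) :=
    {W | W ≠ ⊥ ∧ ∃ s, ∃ h : s ≤ t₀, LinearMap.range (f s t₀ h) = W}
  have hS : S.Nonempty := by
    refine ⟨_, ?_, t₀, le_rfl, rfl⟩
    obtain ⟨v, hv⟩ := exists_ne (0 : V t₀)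
    rw [Submodule.ne_bot_iff]
    exact ⟨v, ⟨v, map_self_apply f v⟩, hv⟩
  -- The images in `V t₀` form a chain, so by finite dimension there is a smallest nonzero one; any
  -- nonzero vector of it works.
  obtain ⟨W, ⟨hW, s₀, h₀, rfl⟩, hmin⟩ := WellFounded.has_min
    (wellFounded_lt : WellFounded ((· < ·) : Submodule K (V t₀) → _ → Prop)) S hS
  obtain ⟨v, hv, hv0⟩ := (Submodule.ne_bot_iff _).1 hW
  refine ⟨v, hv0, fun s h hs => ?_⟩
  rcases le_total s₀ s with hle | hle
  · exact range_mono f hle h hv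
  · have := hmin _ ⟨hs, s, h, rfl⟩
    rwa [(range_mono f hle h₀).eq_of_not_lt this]

/-- Compatible lifts of a vector along all the maps to `V t₀` from an up-set of indices. -/
lemma exists_compatible_lifts [∀ t, Module.Finite K (V t)] {t₀ : ℝ} (v : V t₀) (P : ℝ → Prop)
    (hP₀ : P t₀) (hP : ∀ s (h : s ≤ t₀), P s → v ∈ LinearMap.range (f s t₀ h)) :
    ∃ u : ∀ s, s ≤ t₀ ∧ P s → V s,
      (∀ r s hr hs (h : r ≤ s), f r s h (u r hr) = u s hs) ∧ u t₀ ⟨le_rfl, hP₀⟩ = v := by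
  -- By duality the lifting problem becomes an extension problem: a compatible family of vectors is
  -- a compatible family of functionals on the dual spaces, whose transition maps go the other way.
  let ι := {s : ℝ // s ≤ t₀ ∧ P s}ᵒᵈ
  let G : ι → Type (max v w) := fun s => Module.Dual K (V (OrderDual.ofDual s).1)
  let g : ∀ i j : ι, i ≤ j → G i →ₗ[K] G j := fun i j h =>
    Module.Dual.transpose (R := K) (f _ _ h)
  have : DirectedSystem G (g · · ·) :=
    { map_self := fun i x => by
        ext z; exact congrArg x (map_self_apply f z)
      map_map := fun k j i h h' x => by
        ext z; exact congrArg x (map_map_apply f _ _ z) }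
  obtain ⟨φ, hφ, hφ₀⟩ := exists_compatible_functionals g (OrderDual.toDual ⟨t₀, le_rfl, hP₀⟩)
    -- Evaluation at `v` kills the kernel of each transpose because `v` lies in the range of the
    -- original map.
    (Module.Dual.eval K (V t₀) v) (by
      intro j h x hx
      obtain ⟨y, hy⟩ := hP _ (OrderDual.ofDual j).2.1 (OrderDual.ofDual j).2.2
      have := LinearMap.congr_fun hx y
      exact (congrArg x hy).symm.trans this)
  have he : ∀ s (hs : s ≤ t₀ ∧ P s) (x : Module.Dual K (V s)),
      x ((Module.evalEquiv K (V s)).symm (φ (OrderDual.toDual ⟨s, hs⟩))) =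
        φ (OrderDual.toDual ⟨s, hs⟩) x := fun s hs x =>
    Module.apply_evalEquiv_symm_apply K (V s) x _
  refine ⟨fun s hs => (Module.evalEquiv K (V s)).symm (φ (OrderDual.toDual ⟨s, hs⟩)),
    fun r s hr hs h => ?_, ?_⟩
  · rw [← sub_eq_zero, ← Module.forall_dual_apply_eq_zero_iff K]
    intro x
    rw [map_sub, he, sub_eq_zero]
    exact (he r hr (x ∘ₗ f r s h)).trans
      (hφ (OrderDual.toDual ⟨s, hs⟩) (OrderDual.toDual ⟨r, hr⟩) h x)
  · rw [← sub_eq_zero, ← Module.forall_dual_apply_eq_zero_iff K]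
    intro x
    rw [map_sub, he, hφ₀, sub_eq_zero]
    rfl

theorem exists_bar [∀ t, Module.Finite K (V t)] (t₀ : ℝ) [Nontrivial (V t₀)] :
    Nonempty (Bar f) := by
  classical
  obtain ⟨v, hv0, hv⟩ := exists_mem_range_of_range_ne_bot f (t₀ := t₀)
  -- The bar lives where the image in `V t₀` is still nonzero (`P`) and where `v` has not yet died
  -- (`Q`). Each condition is vacuous on the other side of `t₀`.
  let P : ℝ → Prop := fun s => ∀ h : s ≤ t₀, LinearMap.range (f s t₀ h) ≠ ⊥
  let Q : ℝ → Prop := fun s => ∀ h : t₀ ≤ s, f t₀ s h v ≠ 0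
  have hP : ∀ {s t}, s ≤ t → P s → P t := fun h hs ht => fun h0 =>
    hs (h.trans ht) (le_bot_iff.1 ((range_mono f h ht).trans_eq h0))
  have hQ : ∀ {s t}, s ≤ t → Q t → Q s := fun h ht hs => fun h0 =>
    ht (hs.trans h) (by rw [← map_map_apply f hs h, h0, map_zero])
  have hP₀ : P t₀ := fun h => (Submodule.ne_bot_iff _).2 ⟨v, ⟨v, map_self_apply f v⟩, hv0⟩
  have hQ₀ : Q t₀ := fun h => by rwa [map_self_apply f]
  obtain ⟨I, hI⟩ : ∃ I : Interval, I.carrier = {s | P s ∧ Q s} := by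
    have : {s | P s ∧ Q s} ∈ Set.range Interval.carrier := by
      rw [Interval.range_carrier]
      exact ⟨⟨t₀, hP₀, hQ₀⟩, ⟨fun x hx y hy z hz => ⟨hP hz.1 hx.1, hQ hz.2 hy.2⟩⟩⟩
    exact this
  have hmem : ∀ {t}, t ∈ I.carrier ↔ P t ∧ Q t := fun {t} => by rw [hI]; rfl
  obtain ⟨u, hu, hu₀⟩ := exists_compatible_lifts f v P hP₀ fun s h hs => hv s h (hs h)
  let ι := {r : ℝ // t₀ ≤ r ∧ Q r}
  have : DirectedSystem (fun r : ι => V r.1) (fun i j (h : i ≤ j) => f i.1 j.1 h) :=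
    { map_self := fun i x => map_self_apply f x
      map_map := fun k j i h h' x => map_map_apply f h h' x }
  obtain ⟨φ, hφ, hφ₀⟩ := exists_compatible_functionals_apply_eq_one
    (G := fun r : ι => V r.1) (fun i j h => f i.1 j.1 h) ⟨t₀, le_rfl, hQ₀⟩ v
    (fun j h => j.2.2 h)
  let vec : ∀ t, V t := fun t =>
    if h : t ≤ t₀ ∧ P t then u t h else if h : t₀ ≤ t then f t₀ t h v else 0
  let coord : ∀ t, V t →ₗ[K] K := fun t =>
    if h : t₀ ≤ t ∧ Q t then φ ⟨t, h⟩
    else if h : t ≤ t₀ then φ ⟨t₀, le_rfl, hQ₀⟩ ∘ₗ f t t₀ h else 0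
  have vec_low : ∀ {t} (h : t ≤ t₀ ∧ P t), vec t = u t h := fun h => dif_pos h
  have vec_high : ∀ {t} (h : t₀ ≤ t), vec t = f t₀ t h v := by
    intro t h
    by_cases h' : t ≤ t₀ ∧ P t
    · obtain rfl := le_antisymm h h'.1
      rw [vec_low h', hu₀, map_self_apply f]
    · simp only [vec, dif_neg h', dif_pos h]
  have map_vec_low : ∀ {t} (h : t ≤ t₀), P t → f t t₀ h (vec t) = v := fun {t} h ht => by
    rw [vec_low ⟨h, ht⟩, hu t t₀ ⟨h, ht⟩ ⟨le_rfl, hP₀⟩ h, hu₀]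
  have map_vec : ∀ {s t} (h : s ≤ t), P s → f s t h (vec s) = vec t := by
    intro s t h hs
    rcases le_total t t₀ with ht | ht
    · rw [vec_low ⟨h.trans ht, hs⟩, vec_low ⟨ht, hP h hs⟩]
      exact hu _ _ _ _ h
    · rw [vec_high ht]
      rcases le_total s t₀ with hs' | hs'
      · rw [← map_map_apply f hs' ht, map_vec_low hs' hs]
      · rw [vec_high hs', map_map_apply f]
  have coord_high : ∀ {t} (h : t₀ ≤ t ∧ Q t), coord t = φ ⟨t, h⟩ := fun h => dif_pos h
  have coord_low : ∀ {t} (h : t ≤ t₀) z, coord t z = φ ⟨t₀, le_rfl, hQ₀⟩ (f t t₀ h z) := by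
    intro t h z
    by_cases h' : t₀ ≤ t ∧ Q t
    · obtain rfl := le_antisymm h h'.1
      rw [coord_high h', map_self_apply f]
    · simp only [coord, dif_neg h', dif_pos h]
      rfl
  have coord_map : ∀ {s t} (h : s ≤ t), Q t → ∀ z, coord t (f s t h z) = coord s z := by
    intro s t h ht z
    rcases le_total t t₀ with ht' | ht'
    · rw [coord_low ht', coord_low (h.trans ht'), map_map_apply f]
    · rw [coord_high ⟨ht', ht⟩]
      rcases le_total s t₀ with hs | hs
      · rw [coord_low hs, ← map_map_apply f hs ht']
        exact hφ ⟨t₀, le_rfl, hQ₀⟩ ⟨t, ht', ht⟩ ht' _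
      · rw [coord_high ⟨hs, hQ h ht⟩]
        exact hφ ⟨s, hs, hQ h ht⟩ ⟨t, ht', ht⟩ h _
  refine ⟨⟨I, vec, coord, fun h hs => map_vec h (hmem.1 hs).1, fun {t} ht => ?_,
    fun h ht => coord_map h (hmem.1 ht).2, fun {t} ht => ?_, fun {t} ht => ?_⟩⟩
  · rw [hmem, not_and_or] at ht
    rcases ht with ht | ht
    · obtain ⟨h, -⟩ := not_forall.1 ht
      have h' : ¬ t₀ ≤ t := fun h' => ht (by rwa [le_antisymm h h'])
      simp only [vec, dif_neg (fun h => ht h.2 : ¬ (t ≤ t₀ ∧ P t)), dif_neg h']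
    · obtain ⟨h, hz⟩ := not_forall.1 ht
      rw [vec_high h, not_not.1 hz]
  · rw [hmem, not_and_or] at ht
    rcases ht with ht | ht
    · obtain ⟨h, hz⟩ := not_forall.1 ht
      -- Before birth the map to `V t₀` is zero, so the pulled-back functional vanishes. This is why
      -- birth is defined by nonzero images and not by `v` alone.
      ext z
      have : f t t₀ h z = 0 := by
        rw [← Submodule.mem_bot K, ← not_not.1 hz]
        exact LinearMap.mem_range_self _ z
      rw [coord_low h, this, map_zero, LinearMap.zero_apply]
    · obtain ⟨h, -⟩ := not_forall.1 ht
      have h' : ¬ t ≤ t₀ := fun h' => ht (by rwa [le_antisymm h' h])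
      simp only [coord, dif_neg (fun h => ht h.2 : ¬ (t₀ ≤ t ∧ Q t)), dif_neg h']
  · rw [hmem] at ht
    rcases le_total t t₀ with h | h
    · rw [coord_low h, map_vec_low h ht.1, hφ₀]
    · rw [vec_high h, coord_map h ht.2, coord_low le_rfl, map_self_apply f, hφ₀]

end Bars

/-! ### Decomposition into interval summands -/

section Decomposition

variable {K : Type v} [Field K] {V : ℝ → Type w} [∀ t, AddCommGroup (V t)]
  [∀ t, Module K (V t)] {f : ∀ s t : ℝ, s ≤ t → V s →ₗ[K] V t} {X : Type*}

/-- A family of bars is orthogonal if the coordinates of the vectors of one bar with respect to the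
others vanish. -/
def Bar.Orthogonal (b : X → Bar f) : Prop :=
  ∀ x y, x ≠ y → ∀ t, (b x).coord t ((b y).vec t) = 0

lemma Bar.coord_apply_eq_zero (p : Bar f) {t : ℝ} (ht : t ∉ p.I.carrier) (z : V t) :
    p.coord t z = 0 := by
  rw [p.coord_eq_zero ht, LinearMap.zero_apply]

lemma Bar.Orthogonal.finite {b : X → Bar f} (hb : Bar.Orthogonal b) (t : ℝ)
    [Module.Finite K (V t)] : {x | t ∈ (b x).I.carrier}.Finite := by
  have hli : LinearIndependent K fun x : {x | t ∈ (b x).I.carrier} => (b x).vec t := by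
    rw [linearIndependent_iff']
    intro s g hg x hx
    have h := congrArg ((b x).coord t) hg
    rw [map_sum, map_zero, Finset.sum_eq_single x] at h
    · rwa [map_smul, (b x).coord_vec x.2, smul_eq_mul, mul_one] at h
    · intro y _ hy
      rw [map_smul, hb _ _ (fun h => hy (Subtype.ext h.symm)), smul_zero]
    · exact fun h => absurd hx h
  exact Set.finite_coe_iff.1 hli.finite

/-- The component of a vector in the span of an orthogonal family of bars. -/
def Bar.Orthogonal.part {b : X → Bar f} (hb : Bar.Orthogonal b) (t : ℝ)
    [Module.Finite K (V t)] : V t →ₗ[K] V t :=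
  ∑ x ∈ (hb.finite t).toFinset, ((b x).coord t).smulRight ((b x).vec t)

lemma Bar.Orthogonal.part_apply {b : X → Bar f} (hb : Bar.Orthogonal b) (t : ℝ)
    [Module.Finite K (V t)] (z : V t) :
    hb.part t z = ∑ x ∈ (hb.finite t).toFinset, (b x).coord t z • (b x).vec t := by
  simp [part]

lemma Bar.Orthogonal.coord_part {b : X → Bar f} (hb : Bar.Orthogonal b) (t : ℝ)
    [Module.Finite K (V t)] (x : X) (z : V t) :
    (b x).coord t (hb.part t z) = (b x).coord t z := by
  by_cases hx : t ∈ (b x).I.carrier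
  · rw [part_apply, map_sum, Finset.sum_eq_single x]
    · rw [map_smul, (b x).coord_vec hx, smul_eq_mul, mul_one]
    · intro y _ hy
      rw [map_smul, hb _ _ hy.symm, smul_zero]
    · exact fun h => absurd ((hb.finite t).mem_toFinset.2 hx) h
  · rw [coord_apply_eq_zero _ hx, coord_apply_eq_zero _ hx]

lemma Bar.Orthogonal.part_vec {b : X → Bar f} (hb : Bar.Orthogonal b) (t : ℝ)
    [Module.Finite K (V t)] (x : X) : hb.part t ((b x).vec t) = (b x).vec t := by
  by_cases hx : t ∈ (b x).I.carrier
  · rw [part_apply, Finset.sum_eq_single x]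
    · rw [(b x).coord_vec hx, one_smul]
    · intro y _ hy
      rw [hb _ _ hy, zero_smul]
    · exact fun h => absurd ((hb.finite t).mem_toFinset.2 hx) h
  · rw [(b x).vec_eq_zero hx, map_zero]

/-- The two sums run over the bars alive at `s` and at `t`. They agree because a bar absent at `s`
has zero coordinate there and a bar absent at `t` has zero vector there. -/
lemma Bar.Orthogonal.map_part {b : X → Bar f} (hb : Bar.Orthogonal b) {s t : ℝ} (h : s ≤ t)
    [Module.Finite K (V s)] [Module.Finite K (V t)] (z : V s) :
    f s t h (hb.part s z) = hb.part t (f s t h z) := by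
  classical
  have h1 : f s t h (hb.part s z) =
      ∑ x ∈ (hb.finite s).toFinset, (b x).coord s z • (b x).vec t := by
    rw [part_apply, map_sum]
    refine Finset.sum_congr rfl fun x hx => ?_
    rw [map_smul, (b x).map_vec h ((hb.finite s).mem_toFinset.1 hx)]
  have h2 : hb.part t (f s t h z) =
      ∑ x ∈ (hb.finite t).toFinset, (b x).coord s z • (b x).vec t := by
    rw [part_apply]
    refine Finset.sum_congr rfl fun x hx => ?_
    rw [(b x).coord_map h ((hb.finite t).mem_toFinset.1 hx)]
  rw [h1, h2]
  trans ∑ x ∈ (hb.finite s).toFinset ∪ (hb.finite t).toFinset, (b x).coord s z • (b x).vec t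
  · refine Finset.sum_subset Finset.subset_union_left fun x _ hx => ?_
    rw [Set.Finite.mem_toFinset] at hx
    rw [(b x).coord_apply_eq_zero hx, zero_smul]
  · refine (Finset.sum_subset Finset.subset_union_right fun x _ hx => ?_).symm
    rw [Set.Finite.mem_toFinset] at hx
    rw [(b x).vec_eq_zero hx, smul_zero]

/-- The bars of an orthogonal family are the summands of a direct sum decomposition. -/
structure IsBarBasis (b : X → Bar f) : Prop where
  orthogonal : Bar.Orthogonal b
  eq_zero : ∀ t (z : V t), (∀ x, (b x).coord t z = 0) → z = 0

lemma IsBarBasis.sum_coord {b : X → Bar f} (hb : IsBarBasis b) (t : ℝ)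
    [Module.Finite K (V t)] (z : V t) :
    ∑ x ∈ (hb.orthogonal.finite t).toFinset, (b x).coord t z • (b x).vec t = z := by
  rw [← hb.orthogonal.part_apply, ← sub_eq_zero]
  exact hb.eq_zero t _ fun x => by rw [map_sub, hb.orthogonal.coord_part, sub_self]

/-- The structure theorem for pointwise finite dimensional persistence modules. -/
theorem exists_isBarBasis [DirectedSystem V (f · · ·)] [∀ t, Module.Finite K (V t)] :
    ∃ A : Set (Bar f), IsBarBasis (Subtype.val : A → Bar f) := by
  obtain ⟨A, hA⟩ := zorn_subset
    {A : Set (Bar f) | Bar.Orthogonal (Subtype.val : A → Bar f)} (by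
      intro c hc hchain
      refine ⟨⋃₀ c, ?_, fun s hs => Set.subset_sUnion_of_mem hs⟩
      rintro ⟨p, P, hP, hp⟩ ⟨q, Q, hQ, hq⟩ hne t
      rcases hchain.total hP hQ with h | h
      · exact hc hQ ⟨p, h hp⟩ ⟨q, hq⟩ (fun h => hne (Subtype.ext (Subtype.mk.inj h))) t
      · exact hc hP ⟨p, hp⟩ ⟨q, h hq⟩ (fun h => hne (Subtype.ext (Subtype.mk.inj h))) t)
  have horth : Bar.Orthogonal (Subtype.val : A → Bar f) := hA.prop
  refine ⟨A, horth, fun t₀ z₀ hz₀ => ?_⟩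
  by_contra hne
  -- The candidate complement of the span of the family, stable under the transition maps.
  let C : ∀ t, Submodule K (V t) := fun t => ⨅ p : A, LinearMap.ker (p.1.coord t)
  have hC : ∀ {t z}, z ∈ C t ↔ ∀ p : A, p.1.coord t z = 0 := fun {t z} => by
    simp [C]
  have hmap : ∀ s t (h : s ≤ t), ∀ z ∈ C s, f s t h z ∈ C t := by
    intro s t h z hz
    rw [hC] at hz ⊢
    intro p
    by_cases ht : t ∈ p.1.I.carrier
    · rw [p.1.coord_map h ht, hz]
    · rw [p.1.coord_apply_eq_zero ht]
  let g : ∀ s t : ℝ, s ≤ t → C s →ₗ[K] C t := fun s t h => (f s t h).restrict (hmap s t h)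
  have : DirectedSystem (fun t => C t) (g · · ·) :=
    { map_self := fun t z => Subtype.ext (map_self_apply f z.1)
      map_map := fun k j i h h' z => Subtype.ext (map_map_apply f h h' z.1) }
  have : Nontrivial (C t₀) := ⟨⟨⟨z₀, hC.2 hz₀⟩, 0, fun h => hne (congrArg Subtype.val h)⟩⟩
  obtain ⟨q⟩ := exists_bar g t₀
  -- The projection onto the complement along the span; composing with it turns a bar of `C` into a
  -- bar of `V` orthogonal to the family.
  let π : ∀ t, V t →ₗ[K] C t := fun t =>
    LinearMap.codRestrict (C t) (LinearMap.id - horth.part t) fun z => hC.2 fun p => by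
      rw [LinearMap.sub_apply, map_sub, horth.coord_part, LinearMap.id_apply, sub_self]
  have hπ : ∀ {s t} (h : s ≤ t) z, π t (f s t h z) = g s t h (π s z) := fun {s t} h z =>
    Subtype.ext (by
      change f s t h z - horth.part t (f s t h z) = f s t h (z - horth.part s z)
      rw [map_sub, horth.map_part])
  have hπC : ∀ t (z : C t), π t z = z := fun t z => Subtype.ext (by
    change (z : V t) - horth.part t z = z
    rw [horth.part_apply, Finset.sum_eq_zero, sub_zero]
    intro p _
    rw [hC.1 z.2 p, zero_smul])
  have hπA : ∀ t (p : A), π t (p.1.vec t) = 0 := fun t p => Subtype.ext (by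
    change p.1.vec t - horth.part t (p.1.vec t) = 0
    rw [horth.part_vec t p, sub_self])
  let p : Bar f :=
    { I := q.I
      vec := fun t => q.vec t
      coord := fun t => q.coord t ∘ₗ π t
      map_vec := fun h hs => congrArg Subtype.val (q.map_vec h hs)
      vec_eq_zero := fun ht => congrArg Subtype.val (q.vec_eq_zero ht)
      coord_map := fun h ht z => by
        rw [LinearMap.comp_apply, hπ, q.coord_map h ht, LinearMap.comp_apply]
      coord_eq_zero := fun ht => by rw [q.coord_eq_zero ht, LinearMap.zero_comp]
      coord_vec := fun ht => by rw [LinearMap.comp_apply, hπC, q.coord_vec ht] }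
  have hpA : ∀ (a : A) t, a.1.coord t (p.vec t) = 0 := fun a t => hC.1 (q.vec t).2 a
  have hAp : ∀ (a : A) t, p.coord t (a.1.vec t) = 0 := fun a t => by
    change q.coord t (π t (a.1.vec t)) = 0
    rw [hπA, map_zero]
  have hpmem : p ∈ A := by
    refine hA.le_of_ge (y := insert p A) ?_ (Set.subset_insert _ _) (Set.mem_insert _ _)
    rintro ⟨a, ha⟩ ⟨a', ha'⟩ hne t
    rcases ha with rfl | ha <;> rcases ha' with rfl | ha'
    · exact absurd rfl hne
    · exact hAp ⟨a', ha'⟩ t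
    · exact hpA ⟨a, ha⟩ t
    · exact horth ⟨a, ha⟩ ⟨a', ha'⟩ (fun h => hne (Subtype.ext (Subtype.mk.inj h))) t
  -- By maximality `p` belongs to the family, so its coordinate of its own vector would be `0` as
  -- well as `1`.
  obtain ⟨t, ht⟩ := between_nonempty p.I.lt
  have := hpA ⟨p, hpmem⟩ t
  rw [p.coord_vec ht] at this
  exact one_ne_zero this

end Decomposition

/-! ### Barcodes and bases of bars -/

section Barcodes

variable {K : Type v} [Field K]

/-- The transition maps of a persistence module. -/
def transition (M : ℝ ⥤ ModuleCat.{w} K) (s t : ℝ) (h : s ≤ t) : M.obj s →ₗ[K] M.obj t :=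
  (M.map (homOfLE h)).hom

instance (M : ℝ ⥤ ModuleCat.{w} K) :
    DirectedSystem (fun t => M.obj t) (transition M · · ·) where
  map_self i x := by
    change (M.map (𝟙 i)).hom x = x
    rw [M.map_id]
    rfl
  map_map k j i h h' x := by
    change (M.map (homOfLE h')).hom ((M.map (homOfLE h)).hom x) =
      (M.map (homOfLE (h.trans h'))).hom x
    rw [← homOfLE_comp h h', M.map_comp]
    rfl

lemma coe_intervalMap (I : Interval) {s t : ℝ} (ht : t ∈ I.carrier) (x : intervalSpace K I s) :
    (intervalMap K I s t x : K) = x := by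
  by_cases hs : s ∈ I.carrier
  · simp [intervalMap, hs, ht]
  · have hx : (x : K) = 0 := by simpa [intervalSpace, hs] using x.2
    simp [intervalMap, hs, hx]

lemma mem_intervalSpace {I : Interval} {t : ℝ} (ht : t ∈ I.carrier) (c : K) :
    c ∈ intervalSpace K I t := by
  simp [intervalSpace, ht]

lemma coe_intervalSpace_eq_zero {I : Interval} {t : ℝ} (ht : t ∉ I.carrier)
    (x : intervalSpace K I t) : (x : K) = 0 := by
  simpa [intervalSpace, ht] using x.2

variable {M : ℝ ⥤ ModuleCat.{w} K} {B : Barcode}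

/-- The transition map of the module of a barcode. -/
def barcodeMap (K : Type v) [Field K] (B : Barcode) (s t : ℝ) :
    (⨁ x : B.Elem, intervalSpace K x.interval s) →ₗ[K] ⨁ x : B.Elem, intervalSpace K x.interval t :=
  DirectSum.lmap fun x : B.Elem => intervalMap K x.interval s t

lemma isBarcodeOf_iff : IsBarcodeOf B M ↔
    ∃ e : ∀ t : ℝ, M.obj t ≃ₗ[K] ⨁ x : B.Elem, intervalSpace K x.interval t,
      ∀ s t (h : s ≤ t) x, e t (transition M s t h x) = barcodeMap K B s t (e s x) :=
  Iff.rfl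

lemma IsBarBasis.isBarcodeOf (hM : IsPFD M) {b : B.Elem → Bar (transition M)}
    (hb : IsBarBasis b) (hI : ∀ x, (b x).I = x.interval) : IsBarcodeOf B M := by
  classical
  have : ∀ t, Module.Finite K (M.obj t) := hM
  let g : ∀ t, (⨁ x : B.Elem, intervalSpace K x.interval t) →ₗ[K] M.obj t := fun t =>
    DirectSum.toModule K B.Elem (M.obj t) fun x =>
      LinearMap.toSpanSingleton K _ ((b x).vec t) ∘ₗ (intervalSpace K x.interval t).subtype
  have hg : ∀ t x c, g t (DirectSum.lof K _ _ x c) = (c : K) • (b x).vec t := fun t x c => by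
    simp [g, DirectSum.toModule_lof]
  have hcoord : ∀ t x z, (b x).coord t (g t z) = (z x : K) := by
    intro t x
    suffices h : (b x).coord t ∘ₗ g t =
        (intervalSpace K x.interval t).subtype ∘ₗ DirectSum.component K _ _ x from
      fun z => LinearMap.congr_fun h z
    refine DirectSum.linearMap_ext K fun y => LinearMap.ext fun c => ?_
    simp only [LinearMap.comp_apply, hg, map_smul]
    by_cases hxy : x = y
    · subst hxy
      rw [DirectSum.component.lof_self]
      by_cases hx : t ∈ (b x).I.carrier
      · rw [(b x).coord_vec hx, smul_eq_mul, mul_one]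
        rfl
      · rw [(b x).vec_eq_zero hx, map_zero, smul_zero]
        rw [hI] at hx
        exact (coe_intervalSpace_eq_zero hx c).symm
    · rw [hb.orthogonal x y hxy, DirectSum.component.of, dif_neg (Ne.symm hxy), smul_zero, map_zero]
  have hbij : ∀ t, Function.Bijective (g t) := by
    intro t
    constructor
    · intro z z' h
      refine DFinsupp.ext fun x => Subtype.ext ?_
      exact (hcoord t x z).symm.trans ((congrArg _ h).trans (hcoord t x z'))
    · intro z
      have hmem : ∀ x, (b x).coord t z ∈ intervalSpace K x.interval t := by
        intro x
        by_cases hx : t ∈ (b x).I.carrier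
        · exact mem_intervalSpace (hI x ▸ hx) _
        · rw [Bar.coord_apply_eq_zero _ hx]
          exact zero_mem _
      refine ⟨∑ x ∈ (hb.orthogonal.finite t).toFinset, DirectSum.lof K _ _ x ⟨_, hmem x⟩, ?_⟩
      rw [map_sum]
      simp only [hg]
      exact hb.sum_coord t z
  let e : ∀ t, (⨁ x : B.Elem, intervalSpace K x.interval t) ≃ₗ[K] M.obj t := fun t =>
    LinearEquiv.ofBijective (g t) (hbij t)
  refine isBarcodeOf_iff.2 ⟨fun t => (e t).symm, fun s t h x => ?_⟩
  obtain ⟨y, rfl⟩ := (e s).surjective x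
  rw [LinearEquiv.symm_apply_apply, LinearEquiv.symm_apply_eq]
  change transition M s t h (g s y) = g t (barcodeMap K B s t y)
  have hnat : transition M s t h ∘ₗ g s = g t ∘ₗ barcodeMap K B s t := by
    refine DirectSum.linearMap_ext K fun x => LinearMap.ext fun c => ?_
    simp only [LinearMap.comp_apply]
    rw [barcodeMap, DirectSum.lmap_lof, hg, hg, map_smul]
    by_cases hs : s ∈ (b x).I.carrier
    · rw [(b x).map_vec h hs]
      by_cases ht : t ∈ (b x).I.carrier
      · rw [coe_intervalMap _ (hI x ▸ ht)]
      · rw [(b x).vec_eq_zero ht, smul_zero, smul_zero]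
    · have hc := coe_intervalSpace_eq_zero (hI x ▸ hs) c
      rw [hc, zero_smul, (Subtype.ext hc : c = 0), map_zero, Submodule.coe_zero, zero_smul]
  exact LinearMap.congr_fun hnat y

lemma IsBarcodeOf.exists_isBarBasis (hB : IsBarcodeOf B M) :
    ∃ b : B.Elem → Bar (transition M), IsBarBasis b ∧ ∀ x, (b x).I = x.interval := by
  classical
  obtain ⟨e, he'⟩ := isBarcodeOf_iff.1 hB
  have he : ∀ s t (h : s ≤ t) z x,
      e t (transition M s t h z) x = intervalMap K x.interval s t (e s z x) := by
    intro s t h z x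
    rw [he', barcodeMap, DirectSum.lmap_apply]
  let u : ∀ (x : B.Elem) t, intervalSpace K x.interval t := fun x t =>
    if h : t ∈ x.interval.carrier then ⟨1, mem_intervalSpace h 1⟩ else 0
  have hu : ∀ x t, t ∈ x.interval.carrier → (u x t : K) = 1 := fun x t h => by
    simp only [u, dif_pos h]
  let vec : ∀ (_ : B.Elem) t, M.obj t := fun x t => (e t).symm (DirectSum.lof K _ _ x (u x t))
  have hself : ∀ x t, e t (vec x t) x = u x t := fun x t => by
    simp only [vec, LinearEquiv.apply_symm_apply]
    rw [DirectSum.lof_eq_of, DirectSum.of_eq_same]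
  have hne : ∀ x y t, x ≠ y → e t (vec y t) x = 0 := fun x y t h => by
    simp only [vec, LinearEquiv.apply_symm_apply]
    rw [DirectSum.lof_eq_of, DirectSum.of_eq_of_ne _ _ _ h]
  let coord : ∀ (_ : B.Elem) t, M.obj t →ₗ[K] K := fun x t =>
    (intervalSpace K x.interval t).subtype ∘ₗ DirectSum.component K _ _ x ∘ₗ (e t).toLinearMap
  have hcoord : ∀ x t z, coord x t z = (e t z x : K) := fun x t z => rfl
  refine ⟨fun x =>
    { I := x.interval
      vec := vec x
      coord := coord x
      map_vec := fun {s t} h hs => ?_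
      vec_eq_zero := fun {t} ht => ?_
      coord_map := fun {s t} h ht z => ?_
      coord_eq_zero := fun {t} ht => ?_
      coord_vec := fun {t} ht => ?_ }, ⟨fun x y hxy t => ?_, fun t z hz => ?_⟩, fun x => rfl⟩
  · refine (e t).injective (DFinsupp.ext fun y => Subtype.ext ?_)
    refine (congrArg Subtype.val (he s t h _ y)).trans ?_
    by_cases hy : y = x
    · subst hy
      by_cases ht : t ∈ y.interval.carrier
      · rw [coe_intervalMap _ ht, hself, hself, hu _ _ hs, hu _ _ ht]
      · rw [coe_intervalSpace_eq_zero ht, coe_intervalSpace_eq_zero ht]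
    · rw [hne _ _ _ hy, hne _ _ _ hy, map_zero]
  · simp only [vec, u, dif_neg ht, map_zero]
  · rw [hcoord, he, coe_intervalMap _ ht, hcoord]
  · exact LinearMap.ext fun z => coe_intervalSpace_eq_zero ht _
  · rw [hcoord, hself, hu _ _ ht]
  · exact congrArg Subtype.val (hne x y t hxy)
  · refine (e t).injective (DFinsupp.ext fun x => Subtype.ext ?_)
    rw [map_zero]
    exact hz x

/-- Pointwise finite dimensional persistence modules have barcodes. -/
theorem exists_isBarcodeOf (hM : IsPFD M) : ∃ B : Barcode, IsBarcodeOf B M := by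
  have : ∀ t, Module.Finite K (M.obj t) := hM
  obtain ⟨A, hA⟩ := exists_isBarBasis (f := transition M)
  have hfin : ∀ I : Interval, Finite {p : A // p.1.I = I} := by
    intro I
    obtain ⟨t, ht⟩ := between_nonempty I.lt
    -- Bars with the same interval are all alive at one `t`, hence finite in number.
    exact ((hA.orthogonal.finite t).subset fun (p : A) (hp : p.1.I = I) =>
      show t ∈ p.1.I.carrier from hp ▸ ht).to_subtype
  let B : Barcode := ⟨fun I => Nat.card {p : A // p.1.I = I}⟩
  let E : B.Elem ≃ A := (Equiv.sigmaCongrRight fun I =>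
    (@Finite.equivFin _ (hfin I)).symm).trans (Equiv.sigmaFiberEquiv fun p : A => p.1.I)
  have hE : ∀ x, (E x).1.I = x.interval := fun x =>
    ((@Finite.equivFin _ (hfin x.1)).symm x.2).2
  refine ⟨B, IsBarBasis.isBarcodeOf hM (b := fun x => (E x).1)
    ⟨fun x y hxy t => hA.orthogonal _ _ (E.injective.ne hxy) t, fun t z hz => ?_⟩ hE⟩
  refine hA.eq_zero t z fun p => ?_
  have := hz (E.symm p)
  rwa [E.apply_symm_apply] at this

end Barcodes

/-! ### Matrices of interleavings -/

section Matrix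

/-- The rows of `F` are independent: pair a linear relation with the column of `G` at an index of
maximal key in its support. Only the diagonal term survives, so that coefficient is `0`. -/
lemma card_le_card_of_unitriangular {K α β Γ : Type*} [Field K] [Fintype α] [Fintype β]
    [DecidableEq α] [LinearOrder Γ] (F : α → β → K) (G : β → α → K) (key : α → Γ)
    (h : ∀ a a', ¬ key a' < key a → ∑ b, F a b * G b a' = if a = a' then 1 else 0) :
    Fintype.card α ≤ Fintype.card β := by
  have hli : LinearIndependent K F := by
    rw [Fintype.linearIndependent_iff]
    intro r hr
    by_contra! hne
    obtain ⟨a₀, ha₀⟩ := hne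
    classical
    obtain ⟨a', ha', hmax⟩ := Finset.exists_max_image (Finset.univ.filter fun a => r a ≠ 0) key
      ⟨a₀, by simpa using ha₀⟩
    have h0 : ∑ a, r a * ∑ b, F a b * G b a' = 0 := by
      simp only [Finset.mul_sum]
      rw [Finset.sum_comm]
      refine Finset.sum_eq_zero fun b _ => ?_
      have hb := congrFun hr b
      simp only [Finset.sum_apply, Pi.smul_apply, smul_eq_mul, Pi.zero_apply] at hb
      simp only [← mul_assoc, ← Finset.sum_mul, hb, zero_mul]
    rw [Finset.sum_eq_single a'] at h0
    · rw [h a' a' (lt_irrefl _), if_pos rfl, mul_one] at h0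
      exact (Finset.mem_filter.1 ha').2 h0
    · intro a _ ha
      by_cases hra : r a = 0
      · rw [hra, zero_mul]
      · rw [h a a' (not_lt.2 (hmax a (by simpa using hra))), if_neg ha, mul_zero]
    · exact fun h => absurd (Finset.mem_univ _) h
  simpa using hli.fintype_card_le_finrank

variable {K : Type v} [Field K] {V W : ℝ → Type w} [∀ t, AddCommGroup (V t)]
  [∀ t, Module K (V t)] [∀ t, AddCommGroup (W t)] [∀ t, Module K (W t)]
  {f : ∀ s t : ℝ, s ≤ t → V s →ₗ[K] V t} {g : ∀ s t : ℝ, s ≤ t → W s →ₗ[K] W t} {δ : ℝ}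

/-- A family of maps `V t → W (t + δ)` that commutes with the transition maps. -/
def IsShiftMap (f : ∀ s t : ℝ, s ≤ t → V s →ₗ[K] V t) (g : ∀ s t : ℝ, s ≤ t → W s →ₗ[K] W t)
    (δ : ℝ) (F : ∀ t, V t →ₗ[K] W (t + δ)) : Prop :=
  ∀ s t (h : s ≤ t) z, F t (f s t h z) = g (s + δ) (t + δ) (by linarith) (F s z)

open Classical in
/-- The coefficient of a family of maps `V t → W (t + δ)` at two bars. -/
def matrixCoeff (F : ∀ t, V t →ₗ[K] W (t + δ)) (p : Bar f) (q : Bar g) : K :=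
  if h : ∃ t, q.coord (t + δ) (F t (p.vec t)) ≠ 0 then
    q.coord (h.choose + δ) (F h.choose (p.vec h.choose))
  else 0

lemma mem_of_coord_map_vec_ne_zero {F : ∀ t, V t →ₗ[K] W (t + δ)} {p : Bar f} {q : Bar g} {t : ℝ}
    (h : q.coord (t + δ) (F t (p.vec t)) ≠ 0) : t ∈ p.I.carrier ∧ t + δ ∈ q.I.carrier := by
  constructor <;> by_contra hc <;> refine h ?_
  · rw [p.vec_eq_zero hc, map_zero, map_zero]
  · rw [q.coord_apply_eq_zero hc]

lemma IsShiftMap.coord_map_vec {F : ∀ t, V t →ₗ[K] W (t + δ)} (hF : IsShiftMap f g δ F)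
    {p : Bar f} {q : Bar g} {s t : ℝ} (h : s ≤ t) (hs : s ∈ p.I.carrier)
    (ht : t + δ ∈ q.I.carrier) :
    q.coord (t + δ) (F t (p.vec t)) = q.coord (s + δ) (F s (p.vec s)) := by
  rw [← p.map_vec h hs, hF, q.coord_map _ ht]

/-- Naturality makes the coefficient independent of the time at which it is read off, so a shift map
is described by one scalar per pair of bars. -/
lemma IsShiftMap.matrixCoeff_eq {F : ∀ t, V t →ₗ[K] W (t + δ)} (hF : IsShiftMap f g δ F)
    {p : Bar f} {q : Bar g} {t : ℝ} (ht : t ∈ p.I.carrier) (ht' : t + δ ∈ q.I.carrier) :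
    matrixCoeff F p q = q.coord (t + δ) (F t (p.vec t)) := by
  by_cases h : ∃ t, q.coord (t + δ) (F t (p.vec t)) ≠ 0
  · rw [matrixCoeff, dif_pos h]
    obtain ⟨hs, hs'⟩ := mem_of_coord_map_vec_ne_zero h.choose_spec
    rcases le_total h.choose t with hle | hle
    · exact (hF.coord_map_vec hle hs ht').symm
    · exact hF.coord_map_vec hle ht hs'
  · rw [matrixCoeff, dif_neg h]
    push Not at h
    exact (h t).symm

lemma IsShiftMap.below {F : ∀ t, V t →ₗ[K] W (t + δ)} (hF : IsShiftMap f g δ F)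
    {p : Bar f} {q : Bar g} (h : matrixCoeff F p q ≠ 0) : q.I.Below δ p.I := by
  by_cases hex : ∃ t, q.coord (t + δ) (F t (p.vec t)) ≠ 0
  · obtain ⟨t, ht⟩ := hex
    obtain ⟨ht1, ht2⟩ := mem_of_coord_map_vec_ne_zero ht
    refine Interval.below_of_forall ht1 ht2 (fun s hst hs => ?_) fun s hts hs => ?_
    · rw [hF.coord_map_vec hst hs ht2] at ht
      exact (mem_of_coord_map_vec_ne_zero ht).2
    · rw [← hF.coord_map_vec hts ht1 hs] at ht
      exact (mem_of_coord_map_vec_ne_zero ht).1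
  · exact absurd (dif_neg hex) h

variable {X Y : Type*} {b : X → Bar f} {c : Y → Bar g} {F : ∀ t, V t →ₗ[K] W (t + δ)}
  {G : ∀ t, W t →ₗ[K] V (t + δ)}

open Classical in
-- Expand `F t` of the vector of `b x` in the bars `c` at time `t + δ`, then apply `G` and the
-- coordinate of `b x'`; the composite is a transition map.
lemma sum_matrixCoeff_mul_of_mem [∀ t, Module.Finite K (W t)] (hb : Bar.Orthogonal b)
    (hc : IsBarBasis c) (hF : IsShiftMap f g δ F) (hG : IsShiftMap g f δ G)
    (hGF : ∀ t (h : t ≤ t + δ + δ) z, G (t + δ) (F t z) = f t (t + δ + δ) h z) (hδ : 0 ≤ δ)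
    {x x' : X} {t : ℝ} (ht : t ∈ (b x).I.carrier) (ht' : t + δ + δ ∈ (b x').I.carrier) :
    ∑ y ∈ (hc.orthogonal.finite (t + δ)).toFinset,
      matrixCoeff F (b x) (c y) * matrixCoeff G (c y) (b x') = if x = x' then 1 else 0 := by
  have h1 : (b x').coord (t + δ + δ) (G (t + δ) (F t ((b x).vec t))) =
      if x = x' then 1 else 0 := by
    rw [hGF t (by linarith), (b x).map_vec _ ht]
    by_cases h : x = x'
    · subst h
      rw [(b x).coord_vec ht', if_pos rfl]
    · rw [hb _ _ (Ne.symm h), if_neg h]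
  rw [← h1, ← hc.sum_coord (t + δ) (F t ((b x).vec t)), map_sum, map_sum]
  refine Finset.sum_congr rfl fun y hy => ?_
  have hy' := (Set.Finite.mem_toFinset _).1 hy
  rw [map_smul, map_smul, hF.matrixCoeff_eq ht hy', hG.matrixCoeff_eq hy' ht', smul_eq_mul]

open Classical in
-- The sum may be cut down to bars close to `x` or `x'`: a nonzero term outside would be a path
-- through a bar close to neither end, which lowers the key.
lemma sum_matrixCoeff_mul [∀ t, Module.Finite K (W t)] (hb : Bar.Orthogonal b)
    (hc : IsBarBasis c) (hF : IsShiftMap f g δ F) (hG : IsShiftMap g f δ G)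
    (hGF : ∀ t (h : t ≤ t + δ + δ) z, G (t + δ) (F t z) = f t (t + δ + δ) h z) (hδ : 0 ≤ δ)
    {x x' : X} (hx : (b x).I.b.shift (2 * δ) < (b x).I.d)
    (hx' : (b x').I.b.shift (2 * δ) < (b x').I.d) (hkey : ¬ (b x').I.key < (b x).I.key)
    {μ : Finset Y}
    (hμ : ∀ y, (b x).I.Close δ (c y).I ∨ (b x').I.Close δ (c y).I → y ∈ μ) :
    ∑ y ∈ μ, matrixCoeff F (b x) (c y) * matrixCoeff G (c y) (b x') =
      if x = x' then 1 else 0 := by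
  have hbelow : ∀ y, matrixCoeff F (b x) (c y) * matrixCoeff G (c y) (b x') ≠ 0 →
      (c y).I.Below δ (b x).I ∧ (b x').I.Below δ (c y).I := fun y hy =>
    ⟨hF.below (left_ne_zero_of_mul hy), hG.below (right_ne_zero_of_mul hy)⟩
  -- If no `t` sees both ends, then `x ≠ x'` since long intervals meet their own shift, and every
  -- nonzero term would again lower the key.
  by_cases hex : ∃ t ∈ (b x).I.carrier, t + δ + δ ∈ (b x').I.carrier
  · obtain ⟨t, ht, ht'⟩ := hex
    rw [← sum_matrixCoeff_mul_of_mem hb hc hF hG hGF hδ ht ht',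
      ← Finset.sum_filter_ne_zero, ← Finset.sum_filter_ne_zero (s := Set.Finite.toFinset _)]
    congr 1
    ext y
    simp only [Finset.mem_filter, Set.Finite.mem_toFinset]
    refine and_congr_left fun hy => ⟨fun _ => ?_, fun _ => ?_⟩
    · exact (hbelow y hy).1.mem (hbelow y hy).2 ht ht'
    · by_contra hyμ
      exact hkey ((hbelow y hy).1.key_lt hδ (hbelow y hy).2 (fun h => hyμ (hμ y (Or.inl h)))
        fun h => hyμ (hμ y (Or.inr h)))
  · push Not at hex
    rw [if_neg, Finset.sum_eq_zero]
    · intro y _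
      by_contra hy
      exact hkey ((hbelow y hy).1.key_lt_of_disjoint (hbelow y hy).2 hx hx' hex)
    · rintro rfl
      obtain ⟨t, ht, ht'⟩ := Interval.exists_mem_of_long hδ hx
      exact hex t ht ht'

/-- The long bars of a module are matched to close bars of any module interleaved with it. -/
theorem exists_injective_close [∀ t, Module.Finite K (W t)] (hb : Bar.Orthogonal b)
    (hc : IsBarBasis c) (hF : IsShiftMap f g δ F) (hG : IsShiftMap g f δ G)
    (hGF : ∀ t (h : t ≤ t + δ + δ) z, G (t + δ) (F t z) = f t (t + δ + δ) h z) (hδ : 0 ≤ δ) :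
    ∃ m : {x // (b x).I.b.shift (2 * δ) < (b x).I.d} → Y,
      Function.Injective m ∧ ∀ x, (b x.1).I.Close δ (c (m x)).I := by
  classical
  have hfin : ∀ x : {x // (b x).I.b.shift (2 * δ) < (b x).I.d},
      {y | (b x.1).I.Close δ (c y).I}.Finite := by
    rintro ⟨x, hx⟩
    obtain ⟨t, ht, ht'⟩ := Interval.exists_mem_of_long hδ hx
    exact (hc.orthogonal.finite (t + δ)).subset fun y hy => hy.1.mem hy.2 ht ht'
  -- Hall's marriage theorem; its counting condition is the rank bound applied to each finite set
  -- `s` of long bars and the bars close to them.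
  obtain ⟨m, hm, hm'⟩ := (Finset.all_card_le_biUnion_card_iff_exists_injective
    fun x => (hfin x).toFinset).1 (by
      intro s
      have := card_le_card_of_unitriangular (α := s)
        (β := (s.biUnion fun x => (hfin x).toFinset : Finset Y))
        (fun x y => matrixCoeff F (b x.1) (c y)) (fun y x => matrixCoeff G (c y) (b x.1))
        (fun x => (b x.1).I.key) (by
          intro x x' hkey
          rw [Finset.sum_coe_sort _ fun y => matrixCoeff F (b x.1) (c y) *
            matrixCoeff G (c y) (b x'.1),
            sum_matrixCoeff_mul hb hc hF hG hGF hδ x.1.2 x'.1.2 hkey]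
          · simp only [Subtype.ext_iff]
          · rintro y (hy | hy)
            · exact Finset.mem_biUnion.2 ⟨x, x.2, (hfin x.1).mem_toFinset.2 hy⟩
            · exact Finset.mem_biUnion.2 ⟨x', x'.2, (hfin x'.1).mem_toFinset.2 hy⟩)
      simpa only [Fintype.card_coe] using this)
  exact ⟨m, hm, fun x => (hfin x).mem_toFinset.1 (hm' x)⟩

end Matrix

/-! ### Partial bijections -/

section PartialBijections

/-- The elements of `α` that an alternating path of `f` and `g` reaches from an element of `A` that
is not in the range of `g`. -/
inductive AlternatingReach {α β : Type*} (A : Set α) (B : Set β) (f : A → β) (g : B → α) : α → Prop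
  | base (a : A) (h : ∀ b, g b ≠ a) : AlternatingReach A B f g a
  | step (a : A) (h : AlternatingReach A B f g a.1) (hb : f a ∈ B) :
      AlternatingReach A B f g (g ⟨f a, hb⟩)

lemma exists_pequiv {α β : Type*} {S : α → β → Prop}
    (hright : ∀ {a b b'}, S a b → S a b' → b = b') (hleft : ∀ {a a' b}, S a b → S a' b → a = a') :
    ∃ σ : α ≃. β, ∀ a b, σ a = some b ↔ S a b := by
  classical
  have h1 : ∀ a b, (if h : ∃ b, S a b then some h.choose else none) = some b ↔ S a b := by
    intro a b
    simp only [Option.dite_none_right_eq_some, Option.some.injEq]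
    exact ⟨fun ⟨h, h'⟩ => h' ▸ h.choose_spec, fun h => ⟨⟨b, h⟩, hright (Exists.choose_spec _) h⟩⟩
  have h2 : ∀ a b, (if h : ∃ a, S a b then some h.choose else none) = some a ↔ S a b := by
    intro a b
    simp only [Option.dite_none_right_eq_some, Option.some.injEq]
    exact ⟨fun ⟨h, h'⟩ => h' ▸ h.choose_spec,
      fun h => ⟨⟨a, h⟩, hleft (Exists.choose_spec (p := fun a => S a b) _) h⟩⟩
  exact ⟨⟨fun a => if h : ∃ b, S a b then some h.choose else none,
    fun b => if h : ∃ a, S a b then some h.choose else none,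
    fun a b => (h2 a b).trans (h1 a b).symm⟩, h1⟩

/-- Two partial injections in opposite directions combine to a partial bijection whose domain and
range contain the domains of both. -/
lemma exists_pequiv_of_injective {α β : Type*} {A : Set α} {B : Set β} {f : A → β} {g : B → α}
    (hf : Function.Injective f) (hg : Function.Injective g) (R : α → β → Prop)
    (hfR : ∀ a : A, R a.1 (f a)) (hgR : ∀ b : B, R (g b) b.1) :
    ∃ σ : α ≃. β, (∀ a ∈ A, ∃ b, σ a = some b) ∧ (∀ b ∈ B, ∃ a, σ a = some b) ∧
      ∀ a b, σ a = some b → R a b := by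
  let C := AlternatingReach A B f g
  -- Use `f` on elements reached by alternating paths and the inverse of `g` elsewhere. An unreached
  -- element of `A` is in the range of `g`, since otherwise it would start a path.
  let S : α → β → Prop := fun a b =>
    (C a ∧ ∃ h : a ∈ A, f ⟨a, h⟩ = b) ∨ (¬ C a ∧ ∃ h : b ∈ B, g ⟨b, h⟩ = a)
  have hright : ∀ {a b b'}, S a b → S a b' → b = b' := by
    rintro a b b' (⟨ha, h, rfl⟩ | ⟨ha, h, h1⟩) (⟨ha', h', rfl⟩ | ⟨ha', h', h2⟩)
    · rfl
    · exact absurd ha ha'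
    · exact absurd ha' ha
    · exact congrArg Subtype.val (hg (h1.trans h2.symm))
  have hleft : ∀ {a a' b}, S a b → S a' b → a = a' := by
    rintro a a' b (⟨ha, h, h1⟩ | ⟨ha, h, h1⟩) (⟨ha', h', h2⟩ | ⟨ha', h', h2⟩)
    · exact congrArg Subtype.val (hf (h1.trans h2.symm))
    · subst h1 h2
      exact absurd (AlternatingReach.step ⟨a, h⟩ ha h') ha'
    · subst h1 h2
      exact absurd (AlternatingReach.step ⟨a', h'⟩ ha' h) ha
    · exact h1.symm.trans h2
  obtain ⟨σ, hσ⟩ := exists_pequiv (S := S) hright hleft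
  refine ⟨σ, fun a ha => ?_, fun b hb => ?_, fun a b hab => ?_⟩
  · simp only [hσ]
    by_cases hC : C a
    · exact ⟨_, Or.inl ⟨hC, ha, rfl⟩⟩
    · have : ∃ b, g b = a := by
        by_contra! h
        exact hC (AlternatingReach.base ⟨a, ha⟩ h)
      obtain ⟨b, hb⟩ := this
      exact ⟨b, Or.inr ⟨hC, b.2, hb⟩⟩
  · simp only [hσ]
    by_cases hC : C (g ⟨b, hb⟩)
    · generalize hz : g ⟨b, hb⟩ = z at hC
      cases hC with
      | base a h => exact absurd hz (h _)
      | step a h hb' => exact ⟨a, Or.inl ⟨h, a.2, (congrArg Subtype.val (hg hz)).symm⟩⟩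
    · exact ⟨_, Or.inr ⟨hC, hb, rfl⟩⟩
  · rcases (hσ a b).1 hab with ⟨-, h, rfl⟩ | ⟨-, h, rfl⟩
    · exact hfR ⟨a, h⟩
    · exact hgR ⟨b, h⟩

end PartialBijections

/-! ### Stability and uniqueness of barcodes -/

section Stability

variable {K : Type v} [Field K] {M N : ℝ ⥤ ModuleCat.{w} K} {B C : Barcode} {δ : ℝ}
  {F : ∀ t, M.obj t →ₗ[K] N.obj (t + δ)} {G : ∀ t, N.obj t →ₗ[K] M.obj (t + δ)}

/-- Barcodes of interleaved persistence modules have a matching. -/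
theorem exists_isDeltaMatching (hM : IsPFD M) (hN : IsPFD N) (hB : IsBarcodeOf B M)
    (hC : IsBarcodeOf C N) (hδ : 0 ≤ δ) (hF : IsShiftMap (transition M) (transition N) δ F)
    (hG : IsShiftMap (transition N) (transition M) δ G)
    (hGF : ∀ t (h : t ≤ t + δ + δ) z, G (t + δ) (F t z) = transition M t (t + δ + δ) h z)
    (hFG : ∀ t (h : t ≤ t + δ + δ) z, F (t + δ) (G t z) = transition N t (t + δ + δ) h z) :
    ∃ σ : B.Elem ≃. C.Elem, IsDeltaMatching δ σ := by
  have : ∀ t, Module.Finite K (M.obj t) := hM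
  have : ∀ t, Module.Finite K (N.obj t) := hN
  obtain ⟨b, hb, hbI⟩ := hB.exists_isBarBasis
  obtain ⟨c, hc, hcI⟩ := hC.exists_isBarBasis
  obtain ⟨m, hm, hm'⟩ := exists_injective_close hb.orthogonal hc hF hG hGF hδ
  obtain ⟨n, hn, hn'⟩ := exists_injective_close hc.orthogonal hb hG hF hFG hδ
  obtain ⟨σ, h1, h2, h3⟩ := exists_pequiv_of_injective
    (A := {x | (b x).I.b.shift (2 * δ) < (b x).I.d})
    (B := {y | (c y).I.b.shift (2 * δ) < (c y).I.d}) (f := m) (g := n) hm hn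
    (fun x y => (b x).I.Close δ (c y).I) hm' fun y => (hn' y).symm
  refine ⟨σ, fun x hx => h1 x ?_, fun y hy => h2 y ?_, fun x y h => ?_, fun x y h => ?_⟩
  · rw [Set.mem_ofPred_eq, hbI]
    exact hx
  · rw [Set.mem_ofPred_eq, hcI]
    exact hy
  · have := h3 x y h
    rw [hbI, hcI] at this
    exact (between_subset_iff x.interval.lt).2
      ⟨(Endpoint.shift_neg_le_iff δ).2 this.1.1, this.2.2⟩
  · have := h3 x y h
    rw [hbI, hcI] at this
    exact (between_subset_iff y.interval.lt).2
      ⟨(Endpoint.shift_neg_le_iff δ).2 this.2.1, this.1.2⟩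

lemma isShiftMap_transition_zero (M : ℝ ⥤ ModuleCat.{w} K) :
    IsShiftMap (transition M) (transition M) 0
      fun t => transition M t (t + 0) (add_zero t).ge := by
  intro s t h z
  rw [map_map_apply (transition M), map_map_apply (transition M)]

lemma Barcode.mult_le_of_injective {φ : B.Elem → C.Elem} (hφ : Function.Injective φ)
    (hI : ∀ x, (φ x).interval = x.interval) (I : Interval) : B.mult I ≤ C.mult I := by
  have h : ∀ k : Fin (B.mult I), ∃ l : Fin (C.mult I), φ ⟨I, k⟩ = ⟨I, l⟩ := by
    intro k
    have hk : (φ ⟨I, k⟩).1 = I := hI ⟨I, k⟩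
    generalize φ ⟨I, k⟩ = y at hk
    obtain ⟨J, l⟩ := y
    subst hk
    exact ⟨l, rfl⟩
  choose l hl using h
  have hinj : Function.Injective l := by
    intro k k' hk
    have hφk : φ ⟨I, k⟩ = φ ⟨I, k'⟩ := by rw [hl, hl, hk]
    have := hφ hφk
    exact eq_of_heq (Sigma.mk.inj this).2
  simpa using Fintype.card_le_of_injective l hinj

/-- For `δ = 0` every interval counts as long and matched intervals coincide, so the matching
compares multiplicities in both directions. -/
lemma IsDeltaMatching.eq {σ : B.Elem ≃. C.Elem} (hσ : IsDeltaMatching 0 σ) : B = C := by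
  have hint : ∀ x y, σ x = some y → x.interval = y.interval := by
    intro x y h
    refine Interval.carrier_injective (Set.Subset.antisymm ?_ ?_)
    · have := hσ.subset_left x y h
      rwa [neg_zero, Endpoint.shift_zero, Endpoint.shift_zero] at this
    · have := hσ.subset_right x y h
      rwa [neg_zero, Endpoint.shift_zero, Endpoint.shift_zero] at this
  have hdom : ∀ x, ∃ y, σ x = some y := fun x => hσ.dom x (by
    simpa only [Barcode.long, Set.mem_ofPred_eq, mul_zero, Endpoint.shift_zero] using x.interval.lt)
  have him : ∀ y, ∃ x, σ x = some y := fun y => hσ.im y (by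
    simpa only [Barcode.long, Set.mem_ofPred_eq, mul_zero, Endpoint.shift_zero] using y.interval.lt)
  choose φ hφ using hdom
  choose ψ hψ using him
  have hle := Barcode.mult_le_of_injective (φ := φ)
    (fun x x' h => σ.inj (hφ x) (h ▸ hφ x')) fun x => (hint _ _ (hφ x)).symm
  have hge := Barcode.mult_le_of_injective (φ := ψ)
    (fun y y' h => Option.some.inj ((hψ y).symm.trans (h ▸ hψ y'))) fun y => hint _ _ (hψ y)
  obtain ⟨m⟩ := B
  obtain ⟨n⟩ := C
  exact congrArg Barcode.mk (funext fun I => le_antisymm (hle I) (hge I))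

/-- A pointwise finite dimensional persistence module has exactly one barcode. -/
theorem existsUnique_isBarcodeOf (hM : IsPFD M) : ∃! B : Barcode, IsBarcodeOf B M := by
  obtain ⟨B, hB⟩ := exists_isBarcodeOf hM
  refine ⟨B, hB, fun C hC => ?_⟩
  obtain ⟨σ, hσ⟩ := exists_isDeltaMatching hM hM hC hB le_rfl (isShiftMap_transition_zero M)
    (isShiftMap_transition_zero M) (fun t h z => map_map_apply (transition M) _ _ z)
    fun t h z => map_map_apply (transition M) _ _ z
  exact hσ.eq

end Stability

/-! ### Sublevel-set filtrations -/

section Sublevel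

variable {T : Type u} [TopologicalSpace T] {γ κ : T → ℝ} {δ : ℝ}

/-- The inclusion of sublevel sets of functions at distance at most `δ`. -/
def sublevelInclusion (h : ∀ y, κ y ≤ γ y + δ) (t : ℝ) :
    (sublevel γ).obj t ⟶ (sublevel κ).obj (t + δ) :=
  TopCat.ofHom ⟨Set.inclusion fun y (hy : γ y ≤ t) =>
    (h y).trans (add_le_add_left hy δ), continuous_inclusion _⟩

variable {K : Type v} [Field K] (H : TopCat.{u} ⥤ ModuleCat.{w} K)

lemma isShiftMap_sublevelInclusion (h : ∀ y, κ y ≤ γ y + δ) :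
    IsShiftMap (transition (sublevel γ ⋙ H)) (transition (sublevel κ ⋙ H)) δ
      fun t => (H.map (sublevelInclusion h t)).hom := by
  intro s t hst z
  have : (sublevel γ).map (homOfLE hst) ≫ sublevelInclusion h t =
      sublevelInclusion h s ≫ (sublevel κ).map (homOfLE (by linarith)) := rfl
  have := congrArg H.map this
  rw [H.map_comp, H.map_comp] at this
  exact LinearMap.congr_fun (congrArg ModuleCat.Hom.hom this) z

lemma map_sublevelInclusion_comp (h : ∀ y, κ y ≤ γ y + δ) (h' : ∀ y, γ y ≤ κ y + δ) (t : ℝ)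
    (ht : t ≤ t + δ + δ) (z : H.obj ((sublevel γ).obj t)) :
    (H.map (sublevelInclusion h' (t + δ))).hom ((H.map (sublevelInclusion h t)).hom z) =
      transition (sublevel γ ⋙ H) t (t + δ + δ) ht z := by
  have : sublevelInclusion h t ≫ sublevelInclusion h' (t + δ) =
      (sublevel γ).map (homOfLE ht) := rfl
  have := congrArg H.map this
  rw [H.map_comp] at this
  exact LinearMap.congr_fun (congrArg ModuleCat.Hom.hom this) z

/-- For a finite distance the supremum itself serves as `δ`, since the pointwise bounds are
non-strict; no approximation is needed. `H` may be any functor to vector spaces. -/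
theorem bottleneckDist_sublevel_le {B C : Barcode} (hγ : IsPFD (sublevel γ ⋙ H))
    (hκ : IsPFD (sublevel κ ⋙ H)) (hB : IsBarcodeOf B (sublevel γ ⋙ H))
    (hC : IsBarcodeOf C (sublevel κ ⋙ H)) : bottleneckDist B C ≤ supDist γ κ := by
  rcases eq_or_ne (supDist γ κ) ⊤ with htop | htop
  · exact htop ▸ le_top
  set δ := (supDist γ κ).toNNReal
  have habs : ∀ y, |γ y - κ y| ≤ δ := by
    intro y
    have h1 : ENNReal.ofReal |γ y - κ y| ≤ supDist γ κ :=
      le_iSup (fun y => ENNReal.ofReal |γ y - κ y|) y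
    exact (ENNReal.ofReal_le_iff_le_toReal htop).1 h1
  have h : ∀ y, κ y ≤ γ y + δ := fun y => by linarith [abs_le.1 (habs y)]
  have h' : ∀ y, γ y ≤ κ y + δ := fun y => by linarith [abs_le.1 (habs y)]
  refine sInf_le ⟨δ, (ENNReal.coe_toNNReal htop).symm, ?_⟩
  exact exists_isDeltaMatching hγ hκ hB hC δ.2 (isShiftMap_sublevelInclusion H h)
    (isShiftMap_sublevelInclusion H h') (map_sublevelInclusion_comp H h h')
    (map_sublevelInclusion_comp H h' h)

end Sublevel

end Persistence

end

theorem mainTheorem2 {K : Type*} [Field K] {T : Type*} [TopologicalSpace T] (γ κ : T → ℝ) (i : ℕ)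
    (hγ : Persistence.IsPFD (Persistence.sublevelHomology K γ i))
    (hκ : Persistence.IsPFD (Persistence.sublevelHomology K κ i)) :
    (∃! B : Persistence.Barcode,
      Persistence.IsBarcodeOf B (Persistence.sublevelHomology K γ i)) ∧
    (∃! C : Persistence.Barcode,
      Persistence.IsBarcodeOf C (Persistence.sublevelHomology K κ i)) ∧
    ∀ B C : Persistence.Barcode,
      Persistence.IsBarcodeOf B (Persistence.sublevelHomology K γ i) →
      Persistence.IsBarcodeOf C (Persistence.sublevelHomology K κ i) →
      Persistence.bottleneckDist B C ≤ Persistence.supDist γ κ := by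
  refine ⟨Persistence.existsUnique_isBarcodeOf hγ, Persistence.existsUnique_isBarcodeOf hκ,
    fun B C hB hC => Persistence.bottleneckDist_sublevel_le _ hγ hκ hB hC⟩
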